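/- Let $N\ge 1$, $m,n_i,k_i\ge 0$, $t_0\in\mathbb R$, $\mathcal N=\{1,\dots,N\}$, and let $\|\cdot\|_\infty$ denote the maximum norm and the induced matrix norm. Consider agents $$\dot y_i=F_i(t,y_i,z_i)+\Gamma_i(t,w_i)u_i,\qquad \dot z_i=Z_i(t,z_i,y_i),\qquad w_i=W_i(y_i,z_i),\qquad i\in\mathcal N,$$ with $y_i(t)\in\mathbb R^m$, $z_i(t)\in\mathbb R^{n_i}$, $w_i(t)\in\mathbb R^{k_i}$, coupled over a graph $(\mathcal N,\mathcal E)$ with neighborhoods $\mathcal N_i$ by the edge-wise funnel law $$u_i=\Gamma_i(t,w_i)^{-1}\sum_{j\in\mathcal N_i}u_{ij},\qquad u_{ij}^p=\mu_{ij}^p\!\left(\frac{y_j^p-y_i^p}{\psi_{ij}^p(t)}\right),\quad p=1,\dots,m .$$ Assume: 1. For $t\ge t_0$, $F_i,Z_i,\Gamma_i$ are measurable in $t$, locally Lipschitz in the remaining variables (with a Lipschitz constant that is locally integrable in $t$), and bounded on compact sets of the remaining variables uniformly in $t$; $W_i$ is locally Lipschitz. 2. $\Gamma_i(t,w)$ is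 invertible for all $i$, $t\ge t_0$, $w$, and $\|\Gamma_i(t,w)^{-1}\|_\infty\le M_\Gamma$ for some constant $M_\Gamma$. 3. The graph is undirected and connected. 4. For every edge and every $p$: $\psi_{ij}^p=\psi_{ji}^p:[t_0,\infty)\to(0,\infty)$ is bounded and $C^1$ with bounded derivative; $\mu_{ij}^p:(-1,1)\to\mathbb R$ is continuous, $\mu_{ij}^p(s)\to\pm\infty$ as $s\to\pm1$, and $\mu_{ij}^p(-s)=-\mu_{ji}^p(s)$. 5. Let $d$ be the diameter of the graph and $\Psi(t)=\max_{p,(i,j)\in\mathcal E}\psi_{ij}^p(t)$. For all locally absolutely continuous $e_i:[t_0,\infty)\to\mathbb R^m$ with $\|e_i(t)\|_\infty\le d\,\Psi(t)$ and all initial values at $t_0$, the system $\dot s=\frac1N\sum_{i}F_i(t,s+e_i,z_i)$, $\dot z_i=Z_i(t,z_i,s+e_i)$, $i\in\mathcal N$, has a Carathéodory solution on $[t_0,\infty)$. Let initial values at $t_0$ be given with $|y_j^p(t_0)-y_i^p(t_0)|<\psi_{ij}^p(t_0)$ for every edge and every $p$. Then the closed loop has a maximal Carathéodory solution with these initial values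 (a solution satisfies $|y_j^p-y_i^p|<\psi_{ij}^p$ for every edge and every $p$ throughout its interval of existence, since $\mu_{ij}^p$ is defined on $(-1,1)$). Let $(y_i,z_i)_{i\in\mathcal N}$ be any such maximal solution, on $[t_0,\omega)$ with $\omega\le\infty$, and suppose that at least one of the following holds. (a) $F_i(t,y,z)=\widehat F(t,y)+\widetilde F_i(t,y,z)$ for all $i$ and $t\ge t_0$, where $\widehat F$ is globally Lipschitz in $y$ uniformly in $t$, and $\|\widetilde F_i(t,y,z)\|_\infty\le M_F$ for all $i$, $t\ge t_0$, $y$, $z$, with some constant $M_F$. (b) There is a constant $M$ with $\|(y_i(t),z_i(t))\|_\infty\le M$ for all $i$ and all $t\in[t_0,\omega)$. Then $\omega=\infty$, and the inputs are bounded on $[t_0,\infty)$: there is $M_u>0$ with $\|u_i(t)\|_\infty\le M_u$ for all $t\ge t_0$ and all $i\in\mathcal N$. (The functions $\psi_{ij}^p$ may tend to zero as $t\to\infty$.) -/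

import Mathlib

open Set Filter Topology MeasureTheory

/-! Vectors `Fin d → ℝ` (and pairs of such) carry the maximum norm. Matrices carry the induced
maximum norm (the maximal absolute row sum). -/
attribute [local instance] Matrix.linftyOpNormedAddCommGroup

/-- `f : [t₀, ∞) × X → E` is (Lebesgue) measurable in `t`, locally Lipschitz in `x` (with a
Lipschitz constant that is locally integrable in `t`), and bounded on each compact subset of `X`
uniformly in `t`. Only the values at `t ≥ t₀` matter. -/
structure IsCaratheodoryField {X E : Type*} [NormedAddCommGroup X] [NormedAddCommGroup E]
    (t₀ : ℝ) (f : ℝ → X → E) : Prop where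
  measurable : ∀ x, AEStronglyMeasurable (fun t => f t x) (volume.restrict (Ici t₀))
  locallyLipschitz : ∀ x₀, ∃ U ∈ 𝓝 x₀, ∃ L : ℝ → ℝ, LocallyIntegrableOn L (Ici t₀) ∧
    ∀ t, t₀ ≤ t → ∀ x ∈ U, ∀ x' ∈ U, ‖f t x - f t x'‖ ≤ L t * ‖x - x'‖
  bounded : ∀ K : Set X, IsCompact K → ∃ M : ℝ, ∀ t, t₀ ≤ t → ∀ x ∈ K, ‖f t x‖ ≤ M

/-- `x` is (locally) absolutely continuous on `[t₀, ω)` and `x' = v` almost everywhere there: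
the Carathéodory meaning of the differential equation `x'(t) = v(t)` on `[t₀, ω)`. -/
def HasCaratheodoryDeriv {E : Type*} [NormedAddCommGroup E] [NormedSpace ℝ E]
    (t₀ : ℝ) (ω : EReal) (x v : ℝ → E) : Prop :=
  (∀ T : ℝ, t₀ ≤ T → (T : EReal) < ω → AbsolutelyContinuousOnInterval x t₀ T) ∧
  ∀ᵐ t : ℝ, t₀ < t → (t : EReal) < ω → HasDerivAt x (v t) t

/-- The data of `N` heterogeneous agents on `[t₀, ∞)`
`y_i' = F_i(t, y_i, z_i) + Γ_i(t, w_i) u_i`, `z_i' = Z_i(t, z_i, y_i)`, `w_i = W_i(y_i, z_i)`,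
with outputs `y_i ∈ ℝ^m`, internal states `z_i ∈ ℝ^(n i)` and introspective outputs
`w_i ∈ ℝ^(k i)`. -/
structure AgentNetwork (N m : ℕ) (n k : Fin N → ℕ) where
  t₀ : ℝ
  F : (i : Fin N) → ℝ → (Fin m → ℝ) → (Fin (n i) → ℝ) → (Fin m → ℝ)
  Z : (i : Fin N) → ℝ → (Fin (n i) → ℝ) → (Fin m → ℝ) → (Fin (n i) → ℝ)
  Γ : (i : Fin N) → ℝ → (Fin (k i) → ℝ) → Matrix (Fin m) (Fin m) ℝ
  W : (i : Fin N) → (Fin m → ℝ) → (Fin (n i) → ℝ) → (Fin (k i) → ℝ)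

/-- The data of an edge-wise funnel coupling: an undirected communication graph, performance
functions `ψ i j p` and coupling functions `μ i j p`; the values `ψ i j p`, `μ i j p` matter only
when `i` and `j` are adjacent, those of `ψ i j p` only on `[t₀, ∞)`, those of `μ i j p` only on
`(-1, 1)`. -/
structure FunnelCoupling (N m : ℕ) where
  graph : SimpleGraph (Fin N)
  ψ : Fin N → Fin N → Fin m → ℝ → ℝ
  μ : Fin N → Fin N → Fin m → ℝ → ℝ

namespace FunnelCoupling

variable {N m : ℕ}

/-- Symmetric performance and coupling functions on a connected graph. -/
structure IsAdmissible (c : FunnelCoupling N m) (t₀ : ℝ) : Prop where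
  connected : c.graph.Connected
  ψ_pos : ∀ i j, c.graph.Adj i j → ∀ p t, t₀ ≤ t → 0 < c.ψ i j p t
  ψ_bounded : ∀ i j, c.graph.Adj i j → ∀ p, ∃ B : ℝ, ∀ t, t₀ ≤ t → c.ψ i j p t ≤ B
  ψ_contDiff : ∀ i j, c.graph.Adj i j → ∀ p, ContDiffOn ℝ 1 (c.ψ i j p) (Ici t₀)
  ψ_deriv_bounded : ∀ i j, c.graph.Adj i j → ∀ p, ∃ B : ℝ, ∀ t, t₀ ≤ t →
    |derivWithin (c.ψ i j p) (Ici t₀) t| ≤ B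
  ψ_symm : ∀ i j, c.graph.Adj i j → ∀ p t, t₀ ≤ t → c.ψ i j p t = c.ψ j i p t
  μ_cont : ∀ i j, c.graph.Adj i j → ∀ p, ContinuousOn (c.μ i j p) (Ioo (-1) 1)
  μ_right : ∀ i j, c.graph.Adj i j → ∀ p, Tendsto (c.μ i j p) (𝓝[<] 1) atTop
  μ_left : ∀ i j, c.graph.Adj i j → ∀ p, Tendsto (c.μ i j p) (𝓝[>] (-1)) atBot
  μ_symm : ∀ i j, c.graph.Adj i j → ∀ p, ∀ s ∈ Ioo (-1 : ℝ) 1, c.μ i j p (-s) = -c.μ j i p s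

/-- The outputs `y` lie inside the funnel at time `t`: `|y_j^p - y_i^p| < ψ_ij^p(t)` for every
edge and every component. -/
def InFunnel (c : FunnelCoupling N m) (t : ℝ) (y : Fin N → Fin m → ℝ) : Prop :=
  ∀ i j, c.graph.Adj i j → ∀ p, |y j p - y i p| < c.ψ i j p t

/-- `Ψ(t)`, the largest performance function over all edges and components at time `t`
(and `0` if there are none). -/
noncomputable def Psi (c : FunnelCoupling N m) (t : ℝ) : ℝ :=
  ⨆ q : {q : Fin N × Fin N × Fin m // c.graph.Adj q.1 q.2.1}, c.ψ q.1.1 q.1.2.1 q.1.2.2 t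

open Classical in
/-- `∑_{j ∈ 𝒩_i} u_ij(t, y_j - y_i)` where `u_ij^p(t, ν) = μ_ij^p(ν^p / ψ_ij^p(t))`. -/
noncomputable def edgeSum (c : FunnelCoupling N m) (i : Fin N) (t : ℝ) (y : Fin N → Fin m → ℝ) :
    Fin m → ℝ :=
  ∑ j with c.graph.Adj i j, fun p => c.μ i j p ((y j p - y i p) / c.ψ i j p t)

end FunnelCoupling

namespace AgentNetwork

variable {N m : ℕ} {n k : Fin N → ℕ}

/-- Regularity of the open loop dynamics. -/
structure IsRegular (S : AgentNetwork N m n k) : Prop where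
  F_field : ∀ i, IsCaratheodoryField S.t₀
    (fun t (x : (Fin m → ℝ) × (Fin (n i) → ℝ)) => S.F i t x.1 x.2)
  Z_field : ∀ i, IsCaratheodoryField S.t₀
    (fun t (x : (Fin m → ℝ) × (Fin (n i) → ℝ)) => S.Z i t x.2 x.1)
  Γ_field : ∀ i, IsCaratheodoryField S.t₀ (S.Γ i)
  W_lipschitz : ∀ i, LocallyLipschitz
    (fun x : (Fin m → ℝ) × (Fin (n i) → ℝ) => S.W i x.1 x.2)

/-- The gain matrices are invertible, with uniformly bounded inverses. -/
def HasBoundedInverseGain (S : AgentNetwork N m n k) : Prop :=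
  (∀ i t w, S.t₀ ≤ t → IsUnit (S.Γ i t w)) ∧
  ∃ M : ℝ, 0 < M ∧ ∀ i t w, S.t₀ ≤ t → ‖(S.Γ i t w)⁻¹‖ ≤ M

/-- The edge-wise funnel coupling law
`u_i = Γ_i(t, w_i)⁻¹ ∑_{j ∈ 𝒩_i} u_ij(t, y_j - y_i)` with `w_i = W_i(y_i, z_i)`. -/
noncomputable def input (S : AgentNetwork N m n k) (c : FunnelCoupling N m) (i : Fin N) (t : ℝ)
    (y : Fin N → Fin m → ℝ) (z : (i : Fin N) → Fin (n i) → ℝ) : Fin m → ℝ :=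
  (S.Γ i t (S.W i (y i) (z i)))⁻¹.mulVec (c.edgeSum i t y)

/-- `(y, z)` is a Carathéodory solution of the closed loop on `[t₀, ω)`, `t₀ < ω ≤ ∞`.
The coupling functions live on `(-1, 1)`, so a solution stays inside the funnel by definition. -/
structure IsSolution (S : AgentNetwork N m n k) (c : FunnelCoupling N m) (ω : EReal)
    (y : ℝ → Fin N → Fin m → ℝ) (z : ℝ → (i : Fin N) → Fin (n i) → ℝ) : Prop where
  lt : (S.t₀ : EReal) < ω
  inFunnel : ∀ t, S.t₀ ≤ t → (t : EReal) < ω → c.InFunnel t (y t)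
  y_deriv : ∀ i, HasCaratheodoryDeriv S.t₀ ω (fun t => y t i)
    (fun t => S.F i t (y t i) (z t i)
      + (S.Γ i t (S.W i (y t i) (z t i))).mulVec (S.input c i t (y t) (z t)))
  z_deriv : ∀ i, HasCaratheodoryDeriv S.t₀ ω (fun t => z t i) (fun t => S.Z i t (z t i) (y t i))

/-- A solution on `[t₀, ω)` that has no proper extension. -/
def IsMaximalSolution (S : AgentNetwork N m n k) (c : FunnelCoupling N m) (ω : EReal)
    (y : ℝ → Fin N → Fin m → ℝ) (z : ℝ → (i : Fin N) → Fin (n i) → ℝ) : Prop :=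
  S.IsSolution c ω y z ∧
  ∀ ω' y' z', S.IsSolution c ω' y' z' → ω ≤ ω' →
    (∀ t, S.t₀ ≤ t → (t : EReal) < ω → y' t = y t ∧ z' t = z t) → ω' = ω

/-- The perturbed blended dynamics
`s' = (1/N) ∑ F_i(t, s + e_i, z_i)`, `z_i' = Z_i(t, z_i, s + e_i)`
has a global solution on `[t₀, ∞)` for all initial values and all absolutely continuous inputs
`e_i` with `‖e_i(t)‖ ≤ d Ψ(t)`, where `d` is the diameter of the graph. -/
def NoFiniteEscape (S : AgentNetwork N m n k) (c : FunnelCoupling N m) : Prop :=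
  ∀ e : ℝ → Fin N → Fin m → ℝ,
    (∀ i, ∀ T : ℝ, S.t₀ ≤ T → AbsolutelyContinuousOnInterval (fun t => e t i) S.t₀ T) →
    (∀ i t, S.t₀ ≤ t → ‖e t i‖ ≤ (c.graph.diam : ℝ) * c.Psi t) →
    ∀ (s₀ : Fin m → ℝ) (z₀ : (i : Fin N) → Fin (n i) → ℝ),
      ∃ (s : ℝ → Fin m → ℝ) (z : ℝ → (i : Fin N) → Fin (n i) → ℝ),
        s S.t₀ = s₀ ∧ z S.t₀ = z₀ ∧
        HasCaratheodoryDeriv S.t₀ ⊤ s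
          (fun t => (1 / (N : ℝ)) • ∑ i, S.F i t (s t + e t i) (z t i)) ∧
        ∀ i, HasCaratheodoryDeriv S.t₀ ⊤ (fun t => z t i)
          (fun t => S.Z i t (z t i) (s t + e t i))

/-- `F_i(t, y, z) = F̂(t, y) + F̃_i(t, y, z)` with `F̂` globally Lipschitz in `y` uniformly in `t`
and all `F̃_i` bounded by one constant. -/
def HasLipschitzPlusBoundedSplitting (S : AgentNetwork N m n k) : Prop :=
  ∃ (Fhat : ℝ → (Fin m → ℝ) → (Fin m → ℝ))
    (Ftilde : (i : Fin N) → ℝ → (Fin m → ℝ) → (Fin (n i) → ℝ) → (Fin m → ℝ)),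
    (∀ i t y z, S.t₀ ≤ t → S.F i t y z = Fhat t y + Ftilde i t y z) ∧
    (∃ L : ℝ, ∀ t y y', S.t₀ ≤ t → ‖Fhat t y - Fhat t y'‖ ≤ L * ‖y - y'‖) ∧
    ∃ M : ℝ, ∀ i t y z, S.t₀ ≤ t → ‖Ftilde i t y z‖ ≤ M

/-- The states `(y_i, z_i)` are uniformly bounded on the interval `[t₀, ω)` of existence. -/
def HasBoundedStates (S : AgentNetwork N m n k) (ω : EReal)
    (y : ℝ → Fin N → Fin m → ℝ) (z : ℝ → (i : Fin N) → Fin (n i) → ℝ) : Prop :=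
  ∃ M : ℝ, ∀ i t, S.t₀ ≤ t → (t : EReal) < ω → ‖(y t i, z t i)‖ ≤ M

end AgentNetwork

/-! The inputs are bounded as soon as every edge difference keeps a fixed relative distance from its
funnel boundary, since the couplings are then evaluated on a compact part of `(-1, 1)`. This margin,
`exists_uniform_funnel_margin`, is the heart of the proof. It is shown for each output component
separately, for a scalar network `x_i' = f_i + ∑ μ_ij` with `f_i - f_j ≤ C`.

Grow trees in the graph vertex by vertex, and let `θ` be the sum of the funnels along the edges, the
edge of the `h`-th vertex shrunk by `1 - ε h`. The inequalities `x_a - x_b ≤ θ`, for all trees and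
all `a`, `b` in them, are invariant. At a contact `x_a - x_b = θ`, no edge at `a` or `b` can push
the difference outwards strongly, or a larger tree would be violated. The last attached vertex must
be `a` or `b`, and its edge lies close to the funnel boundary and pulls back, or a smaller tree
would be violated (`FunnelTree.of_sub_eq`). The thresholds `ε h` are chosen backwards in `h` so that
this one pull outweighs the other couplings, the constant `C` and the shrinking of `θ`
(`exists_threshold_scale`). Couplings see only ratios to `ψ`, so nothing degenerates when `ψ` tends
to zero. Two-vertex trees give the margin.

The bound `C` comes in case (b) from boundedness of the fields on compact sets, and in case (a) from
the fact that outputs differ by at most `d Ψ`.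

A solution with bounded states and a margin is Lipschitz, so at a finite `ω` it has a limit inside
the funnel and can be continued (`IsMaximalSolution.eq_top_of_lipschitz`). In case (a) state bounds
up to a finite `ω` come from the blended dynamics: the couplings cancel in the sum, so the average
output solves them with the deviations as perturbation. The deviations extend to all times within `d
Ψ`, and by uniqueness the solution coincides with the global one of `NoFiniteEscape`.

Maximal solutions exist by Zorn's lemma and a Carathéodory existence theorem for a clamped closed
loop. -/

section AbsolutelyContinuous

/-! ### Absolutely continuous functions and bounds for a.e. derivatives. -/

theorem LipschitzWith.comp_absolutelyContinuousOnInterval {X Y : Type*} [PseudoMetricSpace X]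
    [PseudoMetricSpace Y] {K : NNReal} {g : X → Y} (hg : LipschitzWith K g) {f : ℝ → X} {a b : ℝ}
    (hf : AbsolutelyContinuousOnInterval f a b) :
    AbsolutelyContinuousOnInterval (fun t => g (f t)) a b := by
  have h0 := Tendsto.const_mul (K : ℝ) hf
  rw [mul_zero] at h0
  refine squeeze_zero (fun E => Finset.sum_nonneg fun i _ => dist_nonneg) (fun E => ?_) h0
  rw [Finset.mul_sum]
  exact Finset.sum_le_sum fun i _ => hg.dist_le_mul _ _

theorem AbsolutelyContinuousOnInterval.fun_finset_sum {ι E : Type*} [NormedAddCommGroup E]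
    (s : Finset ι) {f : ι → ℝ → E} {a b : ℝ}
    (hf : ∀ i ∈ s, AbsolutelyContinuousOnInterval (f i) a b) :
    AbsolutelyContinuousOnInterval (fun t => ∑ i ∈ s, f i t) a b := by
  classical
  induction s using Finset.induction_on with
  | empty =>
    simp only [Finset.sum_empty]
    exact ((LipschitzWith.const (0 : E)).lipschitzOnWith
      (s := uIcc a b)).absolutelyContinuousOnInterval
  | insert i s hi ih =>
    simp only [Finset.sum_insert hi]
    exact (hf i (Finset.mem_insert_self i s)).fun_add
      (ih fun j hj => hf j (Finset.mem_insert_of_mem hj))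

/-- An absolutely continuous function is the integral of its derivative, so a one-sided a.e. bound
on the derivative can be integrated. -/
theorem AbsolutelyContinuousOnInterval.sub_le_integral {f φ : ℝ → ℝ} {a b : ℝ} (hab : a ≤ b)
    (hf : AbsolutelyContinuousOnInterval f a b) (hφ : IntervalIntegrable φ volume a b)
    (hd : ∀ᵐ t, t ∈ Ioo a b → ∃ d, HasDerivAt f d t ∧ d ≤ φ t) :
    f b - f a ≤ ∫ t in a..b, φ t := by
  rw [← hf.integral_deriv_eq_sub]
  refine intervalIntegral.integral_mono_ae_restrict hab hf.intervalIntegrable_deriv hφ ?_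
  rw [← restrict_Ioo_eq_restrict_Icc]
  refine (ae_restrict_iff' measurableSet_Ioo).2 ?_
  filter_upwards [hd] with t ht htm
  obtain ⟨d, hd, hle⟩ := ht htm
  rw [hd.deriv]
  exact hle

theorem AbsolutelyContinuousOnInterval.sub_le_mul {f : ℝ → ℝ} {a b c : ℝ} (hab : a ≤ b)
    (hf : AbsolutelyContinuousOnInterval f a b)
    (hd : ∀ᵐ t, t ∈ Ioo a b → ∃ d, HasDerivAt f d t ∧ d ≤ c) :
    f b - f a ≤ c * (b - a) := by
  have h := hf.sub_le_integral hab (φ := fun _ => c) (by simp) hd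
  rw [intervalIntegral.integral_const, smul_eq_mul, mul_comm] at h
  exact h

/-- A norming functional of `f b - f a` reduces the vector case to the scalar one. -/
theorem AbsolutelyContinuousOnInterval.norm_sub_le_integral {E : Type*} [NormedAddCommGroup E]
    [NormedSpace ℝ E] {f : ℝ → E} {φ : ℝ → ℝ} {a b : ℝ} (hab : a ≤ b)
    (hf : AbsolutelyContinuousOnInterval f a b) (hφ : IntervalIntegrable φ volume a b)
    (hd : ∀ᵐ t, t ∈ Ioo a b → ∃ d, HasDerivAt f d t ∧ ‖d‖ ≤ φ t) :
    ‖f b - f a‖ ≤ ∫ t in a..b, φ t := by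
  obtain ⟨g, hg1, hg⟩ := exists_dual_vector'' ℝ (f b - f a)
  have h := (g.lipschitz.comp_absolutelyContinuousOnInterval hf).sub_le_integral hab hφ (by
    filter_upwards [hd] with t ht htm
    obtain ⟨d, hd, hle⟩ := ht htm
    refine ⟨g d, g.hasFDerivAt.comp_hasDerivAt t hd, ?_⟩
    calc g d ≤ ‖g d‖ := le_abs_self _
      _ ≤ ‖g‖ * ‖d‖ := g.le_opNorm d
      _ ≤ 1 * ‖d‖ := by gcongr
      _ ≤ φ t := by rw [one_mul]; exact hle)
  rw [← map_sub, hg] at h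
  simpa using h

end AbsolutelyContinuous

/-! ### Calculus of Carathéodory derivatives. -/

namespace HasCaratheodoryDeriv

variable {E G : Type*} [NormedAddCommGroup E] [NormedSpace ℝ E] [NormedAddCommGroup G]
  [NormedSpace ℝ G] {t₀ : ℝ} {ω : EReal} {x v : ℝ → E}

theorem clm_comp (h : HasCaratheodoryDeriv t₀ ω x v) (L : E →L[ℝ] G) :
    HasCaratheodoryDeriv t₀ ω (fun t => L (x t)) (fun t => L (v t)) := by
  refine ⟨fun T h1 h2 => L.lipschitz.comp_absolutelyContinuousOnInterval (h.1 T h1 h2), ?_⟩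
  filter_upwards [h.2] with t ht h1 h2
  exact L.hasFDerivAt.comp_hasDerivAt t (ht h1 h2)

theorem apply {ι : Type*} [Fintype ι] {x v : ℝ → ι → ℝ} (h : HasCaratheodoryDeriv t₀ ω x v)
    (p : ι) : HasCaratheodoryDeriv t₀ ω (fun t => x t p) (fun t => v t p) :=
  h.clm_comp (ContinuousLinearMap.proj (R := ℝ) (φ := fun _ : ι => ℝ) p)

theorem finset_sum {ι : Type*} (s : Finset ι) {x v : ι → ℝ → E}
    (h : ∀ i ∈ s, HasCaratheodoryDeriv t₀ ω (x i) (v i)) :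
    HasCaratheodoryDeriv t₀ ω (fun t => ∑ i ∈ s, x i t) (fun t => ∑ i ∈ s, v i t) := by
  refine ⟨fun T h1 h2 => AbsolutelyContinuousOnInterval.fun_finset_sum s
    fun i hi => (h i hi).1 T h1 h2, ?_⟩
  have : ∀ᵐ t : ℝ, ∀ i ∈ s, t₀ < t → (t : EReal) < ω → HasDerivAt (x i) (v i t) t :=
    (Finset.eventually_all s).2 fun i hi => (h i hi).2
  filter_upwards [this] with t ht h1 h2
  exact HasDerivAt.fun_sum fun i hi => ht i hi h1 h2

theorem sub {x' v' : ℝ → E} (h : HasCaratheodoryDeriv t₀ ω x v)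
    (h' : HasCaratheodoryDeriv t₀ ω x' v') :
    HasCaratheodoryDeriv t₀ ω (fun t => x t - x' t) (fun t => v t - v' t) := by
  refine ⟨fun T h1 h2 => (h.1 T h1 h2).fun_sub (h'.1 T h1 h2), ?_⟩
  filter_upwards [h.2, h'.2] with t h1 h2 h3 h4
  exact (h1 h3 h4).sub (h2 h3 h4)

theorem congr_deriv {v' : ℝ → E} (h : HasCaratheodoryDeriv t₀ ω x v)
    (hv : ∀ t : ℝ, t₀ < t → (t : EReal) < ω → v t = v' t) : HasCaratheodoryDeriv t₀ ω x v' := by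
  refine ⟨h.1, ?_⟩
  filter_upwards [h.2] with t ht h1 h2
  rw [← hv t h1 h2]
  exact ht h1 h2

theorem mono {ω' : EReal} (h : HasCaratheodoryDeriv t₀ ω x v) (hω : ω' ≤ ω) :
    HasCaratheodoryDeriv t₀ ω' x v := by
  refine ⟨fun T h1 h2 => h.1 T h1 (h2.trans_le hω), ?_⟩
  filter_upwards [h.2] with t ht h1 h2
  exact ht h1 (h2.trans_le hω)

theorem absolutelyContinuousOnInterval (h : HasCaratheodoryDeriv t₀ ω x v) {a b : ℝ}
    (ha : t₀ ≤ a) (hab : a ≤ b) (hb : (b : EReal) < ω) : AbsolutelyContinuousOnInterval x a b := by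
  refine (h.1 b (ha.trans hab) hb).mono ?_
  rw [uIcc_of_le hab, uIcc_of_le (ha.trans hab)]
  exact Icc_subset_Icc_left ha

theorem continuousOn (h : HasCaratheodoryDeriv t₀ ω x v) {T : ℝ} (hT : t₀ ≤ T)
    (hω : (T : EReal) < ω) : ContinuousOn x (Icc t₀ T) := by
  have := (h.1 T hT hω).continuousOn
  rwa [uIcc_of_le hT] at this

theorem norm_sub_le_integral (h : HasCaratheodoryDeriv t₀ ω x v) {a b : ℝ} {φ : ℝ → ℝ}
    (ha : t₀ ≤ a) (hab : a ≤ b) (hb : (b : EReal) < ω) (hφ : IntervalIntegrable φ volume a b)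
    (hv : ∀ t ∈ Ioo a b, ‖v t‖ ≤ φ t) : ‖x b - x a‖ ≤ ∫ t in a..b, φ t := by
  refine (h.absolutelyContinuousOnInterval ha hab hb).norm_sub_le_integral hab hφ ?_
  filter_upwards [h.2] with t ht htm
  exact ⟨v t, ht (ha.trans_lt htm.1) (lt_trans (EReal.coe_lt_coe htm.2) hb), hv t htm⟩

theorem sub_le_mul {x v : ℝ → ℝ} (h : HasCaratheodoryDeriv t₀ ω x v) {a b c : ℝ}
    (ha : t₀ ≤ a) (hab : a ≤ b) (hb : (b : EReal) < ω) (hv : ∀ t ∈ Ioo a b, v t ≤ c) :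
    x b - x a ≤ c * (b - a) := by
  refine (h.absolutelyContinuousOnInterval ha hab hb).sub_le_mul hab ?_
  filter_upwards [h.2] with t ht htm
  exact ⟨v t, ht (ha.trans_lt htm.1) (lt_trans (EReal.coe_lt_coe htm.2) hb), hv t htm⟩

/-- A Carathéodory solution with bounded derivative is Lipschitz. -/
theorem lipschitzOnWith (h : HasCaratheodoryDeriv t₀ ω x v) {K : NNReal}
    (hv : ∀ t : ℝ, t₀ < t → (t : EReal) < ω → ‖v t‖ ≤ K) :
    LipschitzOnWith K x {t | t₀ ≤ t ∧ (t : EReal) < ω} := by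
  have key : ∀ a b : ℝ, t₀ ≤ a → a ≤ b → (b : EReal) < ω → ‖x b - x a‖ ≤ K * (b - a) := by
    intro a b ha hab hb
    have := h.norm_sub_le_integral ha hab hb (φ := fun _ => (K : ℝ)) (by simp)
      (fun t ht => hv t (ha.trans_lt ht.1) (lt_trans (EReal.coe_lt_coe ht.2) hb))
    rwa [intervalIntegral.integral_const, smul_eq_mul, mul_comm] at this
  refine LipschitzOnWith.of_dist_le_mul fun s hs t ht => ?_
  rcases le_total s t with hst | hst
  · rw [dist_comm, dist_eq_norm, dist_comm, Real.dist_eq, abs_of_nonneg (sub_nonneg.2 hst)]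
    exact key s t hs.1 hst ht.2
  · rw [dist_eq_norm, Real.dist_eq, abs_of_nonneg (sub_nonneg.2 hst)]
    exact key t s ht.1 hst hs.2

end HasCaratheodoryDeriv

/-- Lipschitz functions on `[a, b]` and `[b, c]` that agree at `b` glue to a Lipschitz function. -/
theorem LipschitzOnWith.piecewise_Icc {E : Type*} [PseudoMetricSpace E] {f g : ℝ → E}
    {K : NNReal} {a b c : ℝ} (hf : LipschitzOnWith K f (Icc a b))
    (hg : LipschitzOnWith K g (Icc b c)) (h : f b = g b) :
    LipschitzOnWith K (fun t => if t < b then f t else g t) (Icc a c) := by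
  have key : ∀ s t : ℝ, s ∈ Icc a c → t ∈ Icc a c → s ≤ t →
      dist (if s < b then f s else g s) (if t < b then f t else g t) ≤ K * dist s t := by
    intro s t hs ht hst
    by_cases hsb : s < b
    · by_cases htb : t < b
      · simp only [hsb, htb, if_true]
        exact hf.dist_le_mul s ⟨hs.1, hsb.le⟩ t ⟨ht.1, htb.le⟩
      · simp only [hsb, htb, if_true, if_false]
        rw [not_lt] at htb
        calc dist (f s) (g t) ≤ dist (f s) (f b) + dist (g b) (g t) := by
              rw [← h]; exact (dist_triangle _ (f b) _)
          _ ≤ K * dist s b + K * dist b t := add_le_add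
              (hf.dist_le_mul s ⟨hs.1, hsb.le⟩ b ⟨hs.1.trans hsb.le, le_rfl⟩)
              (hg.dist_le_mul b ⟨le_rfl, htb.trans ht.2⟩ t ⟨htb, ht.2⟩)
          _ = K * dist s t := by
              rw [Real.dist_eq, Real.dist_eq, Real.dist_eq, abs_of_nonpos (by linarith),
                abs_of_nonpos (by linarith), abs_of_nonpos (by linarith)]
              ring
    · have htb : ¬ t < b := fun h => hsb (hst.trans_lt h)
      simp only [hsb, htb, if_false]
      rw [not_lt] at hsb htb
      exact hg.dist_le_mul s ⟨hsb, hs.2⟩ t ⟨htb, ht.2⟩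
  refine LipschitzOnWith.of_dist_le_mul fun s hs t ht => ?_
  rcases le_total s t with hst | hst
  · exact key s t hs ht hst
  · rw [dist_comm, dist_comm s t]
    exact key t s ht hs hst

/-! ### Carathéodory's existence theorem by Euler polygons. -/

section Peano

variable {E : Type*} [NormedAddCommGroup E] [NormedSpace ℝ E]

/-- The values at the grid points `a + k / (n + 1)` of the Euler polygon of `x' = g(t, x)`. -/
noncomputable def eulerNode (g : ℝ → E → E) (a : ℝ) (x₀ : E) (n : ℕ) : ℕ → E
  | 0 => x₀
  | k + 1 => eulerNode g a x₀ n k +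
      ∫ s in (a + k / (n + 1))..(a + (k + 1 : ℕ) / (n + 1)), g s (eulerNode g a x₀ n k)

/-- The step function attached to `eulerNode`. -/
noncomputable def eulerStep (g : ℝ → E → E) (a : ℝ) (x₀ : E) (n : ℕ) (s : ℝ) : E :=
  eulerNode g a x₀ n ⌊(s - a) * (n + 1)⌋₊

/-- The Euler polygon of `x' = g(t, x)` with mesh `1 / (n + 1)`. -/
noncomputable def eulerPolygon (g : ℝ → E → E) (a : ℝ) (x₀ : E) (n : ℕ) (t : ℝ) : E :=
  x₀ + ∫ s in a..t, g s (eulerStep g a x₀ n s)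

variable {g : ℝ → E → E} {M : ℝ} {a : ℝ} {x₀ : E}

/-- The step function takes countably many values, each on a measurable set, so measurability in `t`
at frozen states suffices. -/
theorem aestronglyMeasurable_eulerStep
    (hmeas : ∀ x, AEStronglyMeasurable (fun t => g t x) volume) (n : ℕ) :
    AEStronglyMeasurable (fun s => g s (eulerStep g a x₀ n s)) volume := by
  have hfl : Measurable fun s : ℝ => ⌊(s - a) * ((n : ℝ) + 1)⌋₊ :=
    Nat.measurable_floor.comp ((measurable_id.sub_const a).mul_const _)
  have hU : (⋃ k : ℕ, (fun s : ℝ => ⌊(s - a) * ((n : ℝ) + 1)⌋₊) ⁻¹' {k}) = univ := by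
    ext s; simp
  rw [← Measure.restrict_univ (μ := volume), ← hU, aestronglyMeasurable_iUnion_iff]
  intro k
  refine ((hmeas (eulerNode g a x₀ n k)).restrict).congr ?_
  refine (ae_restrict_iff' (hfl (measurableSet_singleton k))).2 (Eventually.of_forall ?_)
  intro s hs
  have hs' : ⌊(s - a) * ((n : ℝ) + 1)⌋₊ = k := hs
  simp only [eulerStep, hs']

theorem intervalIntegrable_of_bound {E : Type*} [NormedAddCommGroup E] {f : ℝ → E} {M : ℝ} (hf : AEStronglyMeasurable f volume)
    (hM : ∀ t, ‖f t‖ ≤ M) (a b : ℝ) : IntervalIntegrable f volume a b := by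
  refine (intervalIntegrable_const (c := M) (a := a) (b := b) (μ := volume)).mono_fun
    hf.restrict (Eventually.of_forall fun t => ?_)
  exact (hM t).trans (le_abs_self M)

theorem lipschitzWith_integral [CompleteSpace E] {f : ℝ → E} (hf : AEStronglyMeasurable f volume)
    {M : NNReal} (hM : ∀ t, ‖f t‖ ≤ M) (a : ℝ) (x₀ : E) :
    LipschitzWith M fun t => x₀ + ∫ s in a..t, f s := by
  refine LipschitzWith.of_dist_le_mul fun s t => ?_
  have hi := intervalIntegrable_of_bound hf hM
  rw [dist_eq_norm, add_sub_add_left_eq_sub,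
    intervalIntegral.integral_interval_sub_left (hi a s) (hi a t), dist_comm, Real.dist_eq,
    abs_sub_comm]
  exact intervalIntegral.norm_integral_le_of_norm_le_const fun u _ => hM u

/-- On the `k`-th grid interval the floor is `k` except at the right endpoint, a null set. Hence the
integral over that interval is exactly the increment used in `eulerNode`. -/
theorem eulerPolygon_grid (hmeas : ∀ x, AEStronglyMeasurable (fun t => g t x) volume)
    (hM : ∀ t x, ‖g t x‖ ≤ M) (n k : ℕ) :
    eulerPolygon g a x₀ n (a + k / (n + 1)) = eulerNode g a x₀ n k := by
  have hn : (0 : ℝ) < n + 1 := by positivity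
  have hi := intervalIntegrable_of_bound (aestronglyMeasurable_eulerStep (a := a) (x₀ := x₀) hmeas n)
    (fun t => hM t _)
  induction k with
  | zero => simp [eulerPolygon, eulerNode]
  | succ k ih =>
    rw [eulerNode, ← ih, eulerPolygon, eulerPolygon, add_assoc,
      ← intervalIntegral.integral_add_adjacent_intervals (hi a (a + k / (n + 1))) (hi _ _)]
    congr 2
    have hle : a + (k : ℝ) / (n + 1) ≤ a + ((k + 1 : ℕ) : ℝ) / (n + 1) := by
      push_cast
      gcongr
      linarith
    refine intervalIntegral.integral_congr_ae ?_
    have hne : ∀ᵐ s : ℝ, s ≠ a + ((k + 1 : ℕ) : ℝ) / (n + 1) := by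
      simp [ae_iff, measure_singleton]
    filter_upwards [hne] with s hs hmem
    rw [uIoc_of_le hle] at hmem
    have hlt := lt_of_le_of_ne hmem.2 hs
    have h1 : (k : ℝ) ≤ (s - a) * (n + 1) := by
      have := hmem.1.le
      rw [← div_le_iff₀ hn]; linarith
    have h2 : (s - a) * (n + 1) < k + 1 := by
      rw [← lt_div_iff₀ hn]; push_cast at hlt; linarith
    have h3 : ⌊(s - a) * ((n : ℝ) + 1)⌋₊ = k := by
      rw [Nat.floor_eq_iff (le_trans (Nat.cast_nonneg k) h1)]
      exact ⟨h1, h2⟩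
    change _ = g s (eulerPolygon g a x₀ n (a + k / (n + 1)))
    rw [ih]
    simp only [eulerStep, h3]

/-- The step function at `s` is the value of the polygon at the last grid point before `s`, and the
polygon is `M`-Lipschitz. -/
theorem dist_eulerStep_le [CompleteSpace E] {M : NNReal}
    (hmeas : ∀ x, AEStronglyMeasurable (fun t => g t x) volume)
    (hM : ∀ t x, ‖g t x‖ ≤ M) (n : ℕ) {s : ℝ} (hs : a ≤ s) :
    dist (eulerStep g a x₀ n s) (eulerPolygon g a x₀ n s) ≤ M * (1 / (n + 1)) := by
  have hn : (0 : ℝ) < n + 1 := by positivity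
  have hL : LipschitzWith M (eulerPolygon g a x₀ n) :=
    lipschitzWith_integral (aestronglyMeasurable_eulerStep hmeas n) (fun t => hM t _) a x₀
  rw [eulerStep, ← eulerPolygon_grid hmeas hM]
  refine (hL.dist_le_mul _ _).trans (mul_le_mul_of_nonneg_left ?_ M.2)
  have h0 : 0 ≤ (s - a) * (n + 1) := mul_nonneg (by linarith) hn.le
  have h1 := Nat.floor_le h0
  have h2 := Nat.lt_floor_add_one ((s - a) * ((n : ℝ) + 1))
  rw [Real.dist_eq, abs_le]
  have e : s - a = ((s - a) * (n + 1)) / (n + 1) := by field_simp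
  have h3 : (⌊(s - a) * ((n : ℝ) + 1)⌋₊ : ℝ) / (n + 1) ≤ s - a := by
    rw [div_le_iff₀ hn]; exact h1
  have h4 : s - a ≤ (⌊(s - a) * ((n : ℝ) + 1)⌋₊ : ℝ) / (n + 1) + 1 / (n + 1) := by
    rw [← add_div, le_div_iff₀ hn]; exact h2.le
  have h5 : (0 : ℝ) ≤ 1 / (n + 1) := by positivity
  constructor <;> linarith

/-- A subsequence of uniformly Lipschitz functions with a common value at `a` converges pointwise
on `[a, b]`. -/
theorem exists_subseq_tendsto_of_lipschitz [FiniteDimensional ℝ E] {M : NNReal}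
    {f : ℕ → ℝ → E} (hf : ∀ n, LipschitzWith M (f n)) {a b : ℝ} {x₀ : E}
    (h0 : ∀ n, f n a = x₀) :
    ∃ (x : ℝ → E) (φ : ℕ → ℕ), StrictMono φ ∧
      ∀ t ∈ Icc a b, Tendsto (fun n => f (φ n) t) atTop (𝓝 (x t)) := by
  have : ProperSpace E := FiniteDimensional.proper ℝ E
  -- The setting for Arzelà–Ascoli: the common Lipschitz constant gives equicontinuity, and the
  -- common value at `a` confines all graphs to one ball.
  let A : Set (BoundedContinuousFunction (Icc a b) E) :=
    {h | LipschitzWith M h ∧ ∀ t, h t ∈ Metric.closedBall x₀ (M * (b - a))}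
  have hAc : IsClosed A := by
    have : A = (⋂ (s : Icc a b) (t : Icc a b), {h | dist (h s) (h t) ≤ M * dist s t}) ∩
        ⋂ t : Icc a b, {h | h t ∈ Metric.closedBall x₀ (M * (b - a))} := by
      ext h
      simp only [A, mem_ofPred_eq, mem_inter_iff, mem_iInter, lipschitzWith_iff_dist_le_mul]
    rw [this]
    refine IsClosed.inter (isClosed_iInter fun s => isClosed_iInter fun t => ?_)
      (isClosed_iInter fun t => ?_)
    · exact isClosed_le ((BoundedContinuousFunction.lipschitz_eval_const s).continuous.dist
        (BoundedContinuousFunction.lipschitz_eval_const t).continuous) continuous_const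
    · exact Metric.isClosed_closedBall.preimage (BoundedContinuousFunction.lipschitz_eval_const t).continuous
  have hA : IsCompact A := by
    refine BoundedContinuousFunction.arzela_ascoli₂ _ (isCompact_closedBall x₀ (M * (b - a))) A hAc
      (fun h t hh => hh.2 t) ?_
    exact (LipschitzWith.uniformEquicontinuous _ M fun h : A => h.2.1).equicontinuous
  let F : ℕ → BoundedContinuousFunction (Icc a b) E := fun n =>
    BoundedContinuousFunction.mkOfCompact ⟨fun t => f n t, (hf n).continuous.comp continuous_subtype_val⟩
  have hF : ∀ n, F n ∈ A := by
    intro n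
    refine ⟨LipschitzWith.of_dist_le_mul fun s t => (hf n).dist_le_mul s t, fun t => ?_⟩
    rw [Metric.mem_closedBall, ← h0 n]
    refine ((hf n).dist_le_mul t a).trans (mul_le_mul_of_nonneg_left ?_ M.2)
    rw [Real.dist_eq, abs_of_nonneg (by linarith [t.2.1])]
    linarith [t.2.2]
  obtain ⟨y, -, φ, hφ, hy⟩ := hA.tendsto_subseq hF
  refine ⟨fun t => if h : t ∈ Icc a b then y ⟨t, h⟩ else 0, φ, hφ, fun t ht => ?_⟩
  simp only [ht, dif_pos]
  exact ((BoundedContinuousFunction.lipschitz_eval_const (⟨t, ht⟩ : Icc a b)).continuous.tendsto y).comp hy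

/-- Carathéodory's existence theorem for a globally bounded right-hand side. -/
theorem exists_caratheodory_solution [FiniteDimensional ℝ E] {M : NNReal}
    (hmeas : ∀ x, AEStronglyMeasurable (fun t => g t x) volume)
    (hcont : ∀ t, Continuous (g t)) (hM : ∀ t x, ‖g t x‖ ≤ M) (a b : ℝ) (x₀ : E) :
    ∃ x : ℝ → E, x a = x₀ ∧ LipschitzWith M x ∧
      ∀ᵐ t, t ∈ Ioo a b → HasDerivAt x (g t (x t)) t := by
  have : CompleteSpace E := FiniteDimensional.complete ℝ E
  obtain ⟨x, φ, hφ, hx⟩ := exists_subseq_tendsto_of_lipschitz (a := a) (b := b)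
    (f := eulerPolygon g a x₀) (M := M) (x₀ := x₀)
    (fun n => lipschitzWith_integral (aestronglyMeasurable_eulerStep hmeas n) (fun t => hM t _) a x₀)
    (fun n => by simp [eulerPolygon])
  have hstep : ∀ t ∈ Icc a b,
      Tendsto (fun n => eulerStep g a x₀ (φ n) t) atTop (𝓝 (x t)) := by
    intro t ht
    refine (tendsto_iff_of_dist ?_).2 (hx t ht)
    refine squeeze_zero (fun _ => dist_nonneg) (fun n => dist_eulerStep_le hmeas hM (φ n) ht.1) ?_
    have := (tendsto_one_div_add_atTop_nhds_zero_nat (𝕜 := ℝ)).comp hφ.tendsto_atTop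
    simpa using this.const_mul (M : ℝ)
  -- Nothing is known about `x` outside `[a, b]`; the cutoff makes the velocity measurable and
  -- bounded on the whole line.
  let G : ℝ → E := (Icc a b).indicator fun t => g t (x t)
  have hG : AEStronglyMeasurable G volume := by
    refine aestronglyMeasurable_of_tendsto_ae atTop
      (f := fun n => (Icc a b).indicator fun t => g t (eulerStep g a x₀ (φ n) t))
      (fun n => (aestronglyMeasurable_eulerStep hmeas (φ n)).indicator measurableSet_Icc)
      (Eventually.of_forall fun t => ?_)
    by_cases ht : t ∈ Icc a b
    · simp only [G, indicator_of_mem ht]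
      exact ((hcont t).tendsto _).comp (hstep t ht)
    · simp only [G, indicator_of_notMem ht]
      exact tendsto_const_nhds
  have hGM : ∀ t, ‖G t‖ ≤ M := by
    intro t
    by_cases ht : t ∈ Icc a b
    · simp only [G, indicator_of_mem ht]; exact hM t _
    · simp only [G, indicator_of_notMem ht, norm_zero]; exact M.2
  have heq : ∀ t ∈ Icc a b, x t = x₀ + ∫ s in a..t, G s := by
    intro t ht
    refine tendsto_nhds_unique (hx t ht) (Tendsto.const_add x₀ ?_)
    refine intervalIntegral.tendsto_integral_filter_of_dominated_convergence (fun _ => (M : ℝ))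
      (Eventually.of_forall fun n => (aestronglyMeasurable_eulerStep hmeas (φ n)).restrict)
      (Eventually.of_forall fun n => Eventually.of_forall fun s _ => hM s _)
      intervalIntegrable_const (Eventually.of_forall fun s hs => ?_)
    rw [uIoc_of_le ht.1] at hs
    have hs' : s ∈ Icc a b := ⟨hs.1.le, hs.2.trans ht.2⟩
    simp only [G, indicator_of_mem hs']
    exact ((hcont s).tendsto _).comp (hstep s hs')
  -- The primitive of `G` replaces `x`: both agree on `[a, b]`, and the primitive is Lipschitz on
  -- all of `ℝ`.
  refine ⟨fun t => x₀ + ∫ s in a..t, G s, by simp, lipschitzWith_integral hG hGM a x₀, ?_⟩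
  filter_upwards [(intervalIntegrable_of_bound hG hGM a b).ae_hasDerivAt_integral] with t ht htm
  have htI : t ∈ Icc a b := Ioo_subset_Icc_self htm
  have hab : a ≤ b := htI.1.trans htI.2
  have h := (ht (by rwa [uIcc_of_le hab]) a left_mem_uIcc).const_add x₀
  rw [← heq t htI]
  simpa only [G, indicator_of_mem htI] using h

end Peano

/-! ### Growth of the couplings and the choice of thresholds. -/

section CouplingBounds

variable {m : ℝ → ℝ}

/-- Near `-1` the coupling is nonpositive, so an upper bound is needed only on a compact interval
ending at `1 - δ`; the lower bound is symmetric. The form "eventually in `K`" lets finitely many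
couplings share one constant. -/
theorem eventually_coupling_bound (hc : ContinuousOn m (Ioo (-1) 1))
    (hr : Tendsto m (𝓝[<] 1) atTop) (hl : Tendsto m (𝓝[>] (-1)) atBot) {δ : ℝ} (hδ : 0 < δ) :
    ∀ᶠ K in atTop, (∀ s ∈ Ioo (-1 : ℝ) 1, s ≤ 1 - δ → m s ≤ K) ∧
      ∀ s ∈ Ioo (-1 : ℝ) 1, -(1 - δ) ≤ s → -K ≤ m s := by
  obtain ⟨u, hu, hu'⟩ := mem_nhdsGT_iff_exists_Ioo_subset.1 (hl.eventually (eventually_le_atBot 0))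
  obtain ⟨w, hw, hw'⟩ := mem_nhdsLT_iff_exists_Ioo_subset.1 (hr.eventually (eventually_ge_atTop 0))
  simp only [mem_Ioi, mem_Iio] at hu hw
  obtain ⟨A, hA⟩ := (isCompact_Icc (a := u) (b := 1 - δ)).exists_bound_of_continuousOn
    (hc.mono fun s hs => ⟨by linarith [hs.1], by linarith [hs.2]⟩)
  obtain ⟨B, hB⟩ := (isCompact_Icc (a := -(1 - δ)) (b := w)).exists_bound_of_continuousOn
    (hc.mono fun s hs => ⟨by linarith [hs.1], by linarith [hs.2]⟩)
  filter_upwards [eventually_ge_atTop A, eventually_ge_atTop B, eventually_ge_atTop 0]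
    with K h1 h2 h3
  refine ⟨fun s hs hsδ => ?_, fun s hs hsδ => ?_⟩
  · rcases lt_or_ge s u with h | h
    · exact le_trans (hu' ⟨hs.1, h⟩) h3
    · exact ((le_abs_self _).trans (hA s ⟨h, hsδ⟩)).trans h1
  · rcases lt_or_ge w s with h | h
    · have : 0 ≤ m s := hw' ⟨h, hs.2⟩
      linarith
    · have := (neg_le_abs (m s)).trans (hB s ⟨hsδ, h⟩)
      linarith

theorem eventually_coupling_large (hr : Tendsto m (𝓝[<] 1) atTop)
    (hl : Tendsto m (𝓝[>] (-1)) atBot) (R : ℝ) :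
    ∀ᶠ η in 𝓝[>] (0 : ℝ), (∀ s ∈ Ioo (-1 : ℝ) 1, 1 - η ≤ s → R ≤ m s) ∧
      ∀ s ∈ Ioo (-1 : ℝ) 1, s ≤ -(1 - η) → m s ≤ -R := by
  obtain ⟨u, hu, hu'⟩ :=
    mem_nhdsGT_iff_exists_Ioo_subset.1 (hl.eventually (eventually_le_atBot (-R)))
  obtain ⟨w, hw, hw'⟩ := mem_nhdsLT_iff_exists_Ioo_subset.1 (hr.eventually (eventually_ge_atTop R))
  simp only [mem_Ioi, mem_Iio] at hu hw
  have h1 : ∀ᶠ η in 𝓝[>] (0 : ℝ), η < u + 1 :=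
    mem_nhdsWithin_of_mem_nhds (Iio_mem_nhds (by linarith))
  have h2 : ∀ᶠ η in 𝓝[>] (0 : ℝ), η < 1 - w :=
    mem_nhdsWithin_of_mem_nhds (Iio_mem_nhds (by linarith))
  filter_upwards [h1, h2] with η h1 h2
  exact ⟨fun s hs h => hw' ⟨by linarith, hs.2⟩, fun s hs h => hu' ⟨hs.1, by linarith⟩⟩

/-- A scale of thresholds `ε 1 < ε 2 < ⋯` for a finite family of couplings: when an argument
reaches the threshold `ε h`, the coupling exceeds any prescribed affine function of a bound `K`
for the couplings below the threshold `ε (h + 1)`. -/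
theorem exists_threshold_scale {ι : Type*} [Finite ι] {μ : ι → ℝ → ℝ}
    (hc : ∀ i, ContinuousOn (μ i) (Ioo (-1) 1)) (hr : ∀ i, Tendsto (μ i) (𝓝[<] 1) atTop)
    (hl : ∀ i, Tendsto (μ i) (𝓝[>] (-1)) atBot) (A B : ℝ) (n : ℕ) {ε₀ : ℝ}
    (hε₀ : ε₀ ∈ Ioo (0 : ℝ) 1) :
    ∃ ε : ℕ → ℝ, (∀ h, ε h ∈ Ioc 0 ε₀) ∧ ∀ h, h ≤ n → ∃ K, 0 ≤ K ∧
      (∀ i, ∀ s ∈ Ioo (-1 : ℝ) 1, s ≤ 1 - ε (h + 1) → μ i s ≤ K) ∧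
      (∀ i, ∀ s ∈ Ioo (-1 : ℝ) 1, -(1 - ε (h + 1)) ≤ s → -K ≤ μ i s) ∧
      (∀ i, ∀ s ∈ Ioo (-1 : ℝ) 1, 1 - ε h ≤ s → A + B * K ≤ μ i s) ∧
      ∀ i, ∀ s ∈ Ioo (-1 : ℝ) 1, s ≤ -(1 - ε h) → μ i s ≤ -(A + B * K) := by
  -- The condition on `δ` stands inside the existential so that `choose` yields a total function
  -- `next` that can be iterated.
  have step : ∀ δ : ℝ, ∃ η : ℝ, δ ∈ Ioc 0 ε₀ → η ∈ Ioc 0 ε₀ ∧ ∃ K, 0 ≤ K ∧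
      (∀ i, ∀ s ∈ Ioo (-1 : ℝ) 1, s ≤ 1 - δ → μ i s ≤ K) ∧
      (∀ i, ∀ s ∈ Ioo (-1 : ℝ) 1, -(1 - δ) ≤ s → -K ≤ μ i s) ∧
      (∀ i, ∀ s ∈ Ioo (-1 : ℝ) 1, 1 - η ≤ s → A + B * K ≤ μ i s) ∧
      ∀ i, ∀ s ∈ Ioo (-1 : ℝ) 1, s ≤ -(1 - η) → μ i s ≤ -(A + B * K) := by
    intro δ
    by_cases hδ : δ ∈ Ioc 0 ε₀
    · obtain ⟨K, hK, hK0⟩ := ((eventually_all.2 fun i =>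
        eventually_coupling_bound (hc i) (hr i) (hl i) hδ.1).and (eventually_ge_atTop 0)).exists
      obtain ⟨η, hη, hη0⟩ := ((eventually_all.2 fun i =>
        eventually_coupling_large (hr i) (hl i) (A + B * K)).and (Ioc_mem_nhdsGT hε₀.1)).exists
      exact ⟨η, fun _ => ⟨hη0, K, hK0, fun i => (hK i).1, fun i => (hK i).2, fun i => (hη i).1,
        fun i => (hη i).2⟩⟩
    · exact ⟨0, fun h => absurd h hδ⟩
  choose next hnext using step
  have hmem : ∀ k, next^[k] ε₀ ∈ Ioc 0 ε₀ := by
    intro k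
    induction k with
    | zero => exact ⟨hε₀.1, le_rfl⟩
    | succ k ih =>
      rw [Function.iterate_succ_apply']
      exact (hnext _ ih).1
  -- Backward recursion: `ε (n + 1) = ε₀`, and `ε h` is chosen after `ε (h + 1)` because `K` depends
  -- on the latter. Beyond `n + 1` the truncated subtraction keeps the value `ε₀`.
  refine ⟨fun h => next^[n + 1 - h] ε₀, fun h => hmem _, fun h hh => ?_⟩
  have e : n + 1 - h = (n + 1 - (h + 1)) + 1 := by omega
  have := (hnext _ (hmem (n + 1 - (h + 1)))).2
  rw [← Function.iterate_succ_apply' next, Nat.succ_eq_add_one, ← e] at this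
  exact this

end CouplingBounds

/-! ### Trees of shrunken funnels. -/

section FunnelTree

variable {V : Type*} [DecidableEq V] {G : SimpleGraph V} {ψ : V → V → ℝ → ℝ} {ε : ℕ → ℝ}

/-- `FunnelTree G ψ ε U θ`: the vertex set `U` is obtained from one vertex by attaching vertices
successively along edges, and `θ` is the sum of the funnels of these edges, the edge of the
`h`-th vertex being shrunk by the factor `1 - ε h`. -/
inductive FunnelTree (G : SimpleGraph V) (ψ : V → V → ℝ → ℝ) (ε : ℕ → ℝ) :
    Finset V → (ℝ → ℝ) → Prop
  | single (r : V) : FunnelTree G ψ ε {r} fun _ => 0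
  | attach {U : Finset V} {θ : ℝ → ℝ} {a c : V} : FunnelTree G ψ ε U θ → c ∈ U → a ∉ U →
      G.Adj a c → FunnelTree G ψ ε (insert a U) fun t => θ t + (1 - ε (U.card + 1)) * ψ a c t

namespace FunnelTree

theorem card_pos {U : Finset V} {θ : ℝ → ℝ} (h : FunnelTree G ψ ε U θ) : 0 < U.card := by
  cases h with
  | single r => simp
  | attach h hc ha hac => rw [Finset.card_insert_of_notMem ha]; omega

/-- Here `θ` ranges over functions, so finiteness needs the construction: each attachment raises the
cardinality and has finitely many choices. It lets a short time interval be chosen that works for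
all trees at once. -/
theorem finite [Finite V] :
    {q : Finset V × (ℝ → ℝ) | FunnelTree G ψ ε q.1 q.2}.Finite := by
  have := Fintype.ofFinite V
  have key : ∀ k, {q : Finset V × (ℝ → ℝ) | FunnelTree G ψ ε q.1 q.2 ∧ q.1.card ≤ k}.Finite := by
    intro k
    induction k with
    | zero =>
      refine Set.finite_empty.subset ?_
      rintro q ⟨h, hk⟩
      exact absurd h.card_pos (by omega)
    | succ k ih =>
      refine ((Set.finite_range fun r : V => (({r} : Finset V), fun _ : ℝ => (0 : ℝ))).union
        ((ih.prod (Set.finite_univ (α := V × V))).image fun w =>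
          (insert w.2.1 w.1.1, fun t => w.1.2 t + (1 - ε (w.1.1.card + 1)) * ψ w.2.1 w.2.2 t))).subset ?_
      rintro ⟨U, θ⟩ ⟨h, hk⟩
      cases h with
      | single r => exact Or.inl ⟨r, rfl⟩
      | @attach U θ a c h hc ha hac =>
        refine Or.inr ⟨((U, θ), (a, c)), ⟨⟨h, ?_⟩, mem_univ _⟩, rfl⟩
        change (insert a U).card ≤ k + 1 at hk
        rw [Finset.card_insert_of_notMem ha] at hk
        change U.card ≤ k
        omega
  refine (key (Fintype.card V)).subset fun q hq => ⟨hq, Finset.card_le_univ _⟩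

variable {t₀ : ℝ}

theorem nonneg {t : ℝ} (hε : ∀ h, ε h ∈ Ioo (0 : ℝ) 1) (hψ : ∀ i j, G.Adj i j → 0 < ψ i j t)
    {U : Finset V} {θ : ℝ → ℝ} (h : FunnelTree G ψ ε U θ) : 0 ≤ θ t := by
  induction h with
  | single r => exact le_rfl
  | @attach U θ a c h hc ha hac ih =>
    have := mul_nonneg (sub_nonneg.2 (hε (U.card + 1)).2.le) (hψ _ _ hac).le
    exact add_nonneg ih this

theorem continuousOn {s : Set ℝ} (hψ : ∀ i j, G.Adj i j → ContinuousOn (ψ i j) s)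
    {U : Finset V} {θ : ℝ → ℝ} (h : FunnelTree G ψ ε U θ) : ContinuousOn θ s := by
  induction h with
  | single r => exact continuousOn_const
  | attach h hc ha hac ih => exact ih.add (continuousOn_const.mul (hψ _ _ hac))

/-- Each edge contributes at most the rate `B`, its shrinking factor being below `1`. Counting
vertices instead of edges is generous by one. -/
theorem sub_le {s t B : ℝ} (hε : ∀ h, ε h ∈ Ioo (0 : ℝ) 1) (hst : s ≤ t) (hB : 0 ≤ B)
    (hψ : ∀ i j, G.Adj i j → ψ i j s - ψ i j t ≤ B * (t - s))
    {U : Finset V} {θ : ℝ → ℝ} (h : FunnelTree G ψ ε U θ) :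
    θ s - θ t ≤ U.card * B * (t - s) := by
  have hBst := mul_nonneg hB (sub_nonneg.2 hst)
  induction h with
  | single r => simpa using hBst
  | @attach U θ a c h hc ha hac ih =>
    rw [Finset.card_insert_of_notMem ha]
    have h1 := hψ _ _ hac
    have h2 := hε (U.card + 1)
    have h3 : (1 - ε (U.card + 1)) * (ψ a c s - ψ a c t) ≤ (1 - ε (U.card + 1)) * (B * (t - s)) :=
      mul_le_mul_of_nonneg_left h1 (by linarith [h2.2])
    have h4 : 0 ≤ ε (U.card + 1) * (B * (t - s)) := mul_nonneg h2.1.le hBst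
    push_cast
    linarith

/-- The start of the invariance argument: every shrinking factor is at least `1 - ε₀`, so a margin
`ε₀` on all edges adds up along the tree. -/
theorem sub_le_of_margin {t ε₀ : ℝ} {x : V → ℝ} (hε : ∀ h, ε h ∈ Ioc 0 ε₀) (hε₀ : ε₀ < 1)
    (hψ : ∀ i j, G.Adj i j → 0 < ψ i j t)
    (hx : ∀ i j, G.Adj i j → |x j - x i| ≤ (1 - ε₀) * ψ i j t)
    {U : Finset V} {θ : ℝ → ℝ} (h : FunnelTree G ψ ε U θ) :
    ∀ a ∈ U, ∀ b ∈ U, x a - x b ≤ θ t := by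
  have hε' : ∀ h, ε h ∈ Ioo (0 : ℝ) 1 := fun h => ⟨(hε h).1, (hε h).2.trans_lt hε₀⟩
  induction h with
  | single r =>
    intro a ha b hb
    rw [Finset.mem_singleton.1 ha, Finset.mem_singleton.1 hb, sub_self]
  | @attach U θ a c h hc ha hac ih =>
    have hpos := hψ _ _ hac
    have h1 : |x c - x a| ≤ (1 - ε (U.card + 1)) * ψ a c t :=
      (hx _ _ hac).trans (mul_le_mul_of_nonneg_right (by linarith [(hε (U.card + 1)).2]) hpos.le)
    have h2 := abs_le.1 h1
    have h3 := (abs_nonneg _).trans h1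
    have h4 := h.nonneg hε' hψ
    intro p hp q hq
    rcases Finset.mem_insert.1 hp with rfl | hp' <;> rcases Finset.mem_insert.1 hq with rfl | hq'
    · linarith
    · linarith [ih c hc q hq']
    · linarith [ih p hp' c hc]
    · linarith [ih p hp' q hq']

/-- Where the largest admissible difference `x a - x b = θ t` is attained, all edges at `a` and
`b` stay away from the funnel boundary in the direction that increases `x a - x b`, and some edge
is close to the boundary in the direction that decreases it. -/
theorem of_sub_eq {t : ℝ} {x : V → ℝ} (hε : ∀ h, ε h ∈ Ioo (0 : ℝ) 1)
    (hψ : ∀ i j, G.Adj i j → 0 < ψ i j t) (hsymm : ∀ i j, G.Adj i j → ψ i j t = ψ j i t)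
    (hall : ∀ U θ, FunnelTree G ψ ε U θ → ∀ a ∈ U, ∀ b ∈ U, x a - x b ≤ θ t)
    {U : Finset V} {θ : ℝ → ℝ} (h : FunnelTree G ψ ε U θ) {a b : V} (ha : a ∈ U) (hb : b ∈ U)
    (hab : a ≠ b) (heq : x a - x b = θ t) :
    (∀ c, G.Adj a c → (x c - x a) / ψ a c t ≤ 1 - ε (U.card + 1)) ∧
    (∀ c, G.Adj b c → -(1 - ε (U.card + 1)) ≤ (x c - x b) / ψ b c t) ∧
    ((∃ c, G.Adj a c ∧ (x c - x a) / ψ a c t ≤ -(1 - ε U.card)) ∨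
      ∃ c, G.Adj b c ∧ 1 - ε U.card ≤ (x c - x b) / ψ b c t) := by
  refine ⟨fun c hc => ?_, fun c hc => ?_, ?_⟩
  · have hpos := hψ _ _ hc
    rw [div_le_iff₀ hpos]
    -- Inside the tree, `c` cannot lie above `a`, since `x a - x b` already attains `θ t`. Outside,
    -- `c` can be attached at `a`, and the inequality of the larger tree bounds this edge.
    by_cases hcU : c ∈ U
    · have := hall U θ h c hcU b hb
      have := mul_nonneg (sub_nonneg.2 (hε (U.card + 1)).2.le) hpos.le
      linarith
    · have := hall _ _ (h.attach ha hcU hc.symm) c (Finset.mem_insert_self _ _) b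
        (Finset.mem_insert_of_mem hb)
      rw [hsymm _ _ hc]
      linarith
  · have hpos := hψ _ _ hc
    rw [le_div_iff₀ hpos]
    by_cases hcU : c ∈ U
    · have := hall U θ h a ha c hcU
      have := mul_nonneg (sub_nonneg.2 (hε (U.card + 1)).2.le) hpos.le
      linarith
    · have := hall _ _ (h.attach hb hcU hc.symm) a (Finset.mem_insert_of_mem ha) c
        (Finset.mem_insert_self _ _)
      rw [hsymm _ _ hc]
      linarith
  · cases h with
    | single r =>
      exact absurd ((Finset.mem_singleton.1 ha).trans (Finset.mem_singleton.1 hb).symm) hab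
    | @attach U θ d c h hc hd hdc =>
      have hpos := hψ _ _ hdc
      have hlt : 0 < (1 - ε (U.card + 1)) * ψ d c t := mul_pos (by linarith [(hε (U.card + 1)).2]) hpos
      rw [Finset.card_insert_of_notMem hd]
      simp only at heq
      -- The tree without its last vertex `d` has a strictly smaller `θ`. So `d` is `a` or `b`, and
      -- comparison with the smaller tree forces its edge towards the boundary.
      rcases Finset.mem_insert.1 ha with rfl | ha'
      · left
        have hb' : b ∈ U := (Finset.mem_insert.1 hb).resolve_left fun h => hab h.symm
        refine ⟨c, hdc, ?_⟩
        rw [div_le_iff₀ hpos]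
        linarith [hall U θ h c hc b hb']
      · rcases Finset.mem_insert.1 hb with rfl | hb'
        · right
          refine ⟨c, hdc, ?_⟩
          rw [le_div_iff₀ hpos]
          linarith [hall U θ h a ha' c hc]
        · linarith [hall U θ h a ha' b hb']

end FunnelTree

end FunnelTree

/-! ### The uniform funnel margin. -/

section FunnelMargin

theorem Finset.sum_le_add_card_mul {ι : Type*} [DecidableEq ι] {s : Finset ι} {f : ι → ℝ} {c : ι}
    {R K : ℝ} {n : ℕ} (hc : c ∈ s) (hR : f c ≤ R) (hK : 0 ≤ K) (hf : ∀ i ∈ s, f i ≤ K)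
    (hn : s.card ≤ n) : ∑ i ∈ s, f i ≤ R + n * K := by
  rw [← Finset.add_sum_erase s f hc]
  have h1 := Finset.sum_le_card_nsmul (s.erase c) f K fun i hi => hf i (Finset.mem_of_mem_erase hi)
  rw [nsmul_eq_mul] at h1
  have h2 : ((s.erase c).card : ℝ) ≤ n := by
    exact_mod_cast (Finset.card_le_card (Finset.erase_subset c s)).trans hn
  have := mul_le_mul_of_nonneg_right h2 hK
  linarith

theorem Finset.sum_le_card_mul {ι : Type*} {s : Finset ι} {f : ι → ℝ}
    {K : ℝ} {n : ℕ} (hK : 0 ≤ K) (hf : ∀ i ∈ s, f i ≤ K) (hn : s.card ≤ n) :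
    ∑ i ∈ s, f i ≤ n * K := by
  have h1 := Finset.sum_le_card_nsmul s f K hf
  rw [nsmul_eq_mul] at h1
  have h2 : (s.card : ℝ) ≤ n := by exact_mod_cast hn
  have := mul_le_mul_of_nonneg_right h2 hK
  linarith

variable {V : Type*} [Fintype V] [DecidableEq V] {G : SimpleGraph V} [DecidableRel G.Adj]
  {ψ μ : V → V → ℝ → ℝ}

/-- At a contact every coupling at `a` and `b` drives the difference apart by at most `K`, while the
last attached edge contributes at most `-R`. -/
theorem FunnelTree.coupling_sub_le {ε : ℕ → ℝ} {K R : ℝ} {t : ℝ} {x : V → ℝ}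
    (hε : ∀ h, ε h ∈ Ioo (0 : ℝ) 1)
    (hψ : ∀ i j, G.Adj i j → 0 < ψ i j t) (hsymm : ∀ i j, G.Adj i j → ψ i j t = ψ j i t)
    (hin : ∀ i j, G.Adj i j → |x j - x i| < ψ i j t)
    (hall : ∀ U θ, FunnelTree G ψ ε U θ → ∀ a ∈ U, ∀ b ∈ U, x a - x b ≤ θ t)
    {U : Finset V} {θ : ℝ → ℝ} (h : FunnelTree G ψ ε U θ) {a b : V} (ha : a ∈ U) (hb : b ∈ U)
    (hab : a ≠ b) (heq : x a - x b = θ t) (hK0 : 0 ≤ K)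
    (hK1 : ∀ i j, G.Adj i j → ∀ s ∈ Ioo (-1 : ℝ) 1, s ≤ 1 - ε (U.card + 1) → μ i j s ≤ K)
    (hK2 : ∀ i j, G.Adj i j → ∀ s ∈ Ioo (-1 : ℝ) 1, -(1 - ε (U.card + 1)) ≤ s → -K ≤ μ i j s)
    (hR1 : ∀ i j, G.Adj i j → ∀ s ∈ Ioo (-1 : ℝ) 1, 1 - ε U.card ≤ s → R ≤ μ i j s)
    (hR2 : ∀ i j, G.Adj i j → ∀ s ∈ Ioo (-1 : ℝ) 1, s ≤ -(1 - ε U.card) → μ i j s ≤ -R) :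
    ∑ j with G.Adj a j, μ a j ((x j - x a) / ψ a j t) -
      ∑ j with G.Adj b j, μ b j ((x j - x b) / ψ b j t) ≤ -R + 2 * Fintype.card V * K := by
  obtain ⟨h1, h2, h3⟩ := h.of_sub_eq hε hψ hsymm hall ha hb hab heq
  have hmem : ∀ i j, G.Adj i j → (x j - x i) / ψ i j t ∈ Ioo (-1 : ℝ) 1 := by
    intro i j hij
    rw [mem_Ioo, ← abs_lt, abs_div, abs_of_pos (hψ i j hij), div_lt_one (hψ i j hij)]
    exact hin i j hij
  have hA : ∀ j ∈ Finset.univ.filter (G.Adj a), μ a j ((x j - x a) / ψ a j t) ≤ K := by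
    intro j hj
    have hj' := (Finset.mem_filter.1 hj).2
    exact hK1 a j hj' _ (hmem a j hj') (h1 j hj')
  have hB : ∀ j ∈ Finset.univ.filter (G.Adj b), -μ b j ((x j - x b) / ψ b j t) ≤ K := by
    intro j hj
    have hj' := (Finset.mem_filter.1 hj).2
    linarith [hK2 b j hj' _ (hmem b j hj') (h2 j hj')]
  rw [sub_eq_add_neg, ← Finset.sum_neg_distrib]
  rcases h3 with ⟨c, hc, hc'⟩ | ⟨c, hc, hc'⟩
  · have e1 := Finset.sum_le_add_card_mul (c := c) (by simpa using hc)
      (hR2 a c hc _ (hmem a c hc) hc') hK0 hA (Finset.card_le_univ _)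
    have e2 := Finset.sum_le_card_mul hK0 hB (Finset.card_le_univ _)
    linarith
  · have e1 := Finset.sum_le_card_mul hK0 hA (Finset.card_le_univ _)
    have e2 := Finset.sum_le_add_card_mul (c := c) (by simpa using hc)
      (neg_le_neg (hR1 b c hc _ (hmem b c hc) hc')) hK0 hB (Finset.card_le_univ _)
    linarith

/-- Solutions of a scalar funnel coupled network whose uncoupled parts differ by a bounded amount
keep a uniform relative distance from the funnel boundary. -/
theorem exists_uniform_funnel_margin {t₀ C : ℝ} {ω : EReal} {B : NNReal} (hω : (t₀ : EReal) < ω)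
    (hψ : ∀ i j, G.Adj i j → ∀ t, t₀ ≤ t → 0 < ψ i j t)
    (hsymm : ∀ i j, G.Adj i j → ∀ t, t₀ ≤ t → ψ i j t = ψ j i t)
    (hlip : ∀ i j, G.Adj i j → LipschitzOnWith B (ψ i j) (Ici t₀))
    (hμc : ∀ i j, G.Adj i j → ContinuousOn (μ i j) (Ioo (-1) 1))
    (hμr : ∀ i j, G.Adj i j → Tendsto (μ i j) (𝓝[<] 1) atTop)
    (hμl : ∀ i j, G.Adj i j → Tendsto (μ i j) (𝓝[>] (-1)) atBot)
    {x f : V → ℝ → ℝ}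
    (hx : ∀ i, HasCaratheodoryDeriv t₀ ω (x i)
      fun t => f i t + ∑ j with G.Adj i j, μ i j ((x j t - x i t) / ψ i j t))
    (hf : ∀ i j t, t₀ ≤ t → (t : EReal) < ω → f i t - f j t ≤ C)
    (hin : ∀ i j, G.Adj i j → ∀ t, t₀ ≤ t → (t : EReal) < ω → |x j t - x i t| < ψ i j t) :
    ∃ ε ∈ Ioo (0 : ℝ) 1, ∀ i j, G.Adj i j → ∀ t, t₀ ≤ t → (t : EReal) < ω →
      |x j t - x i t| ≤ (1 - ε) * ψ i j t := by
  obtain ⟨ε₀, hε₀x, hε₀⟩ : ∃ ε₀, (∀ i j, G.Adj i j → |x j t₀ - x i t₀| ≤ (1 - ε₀) * ψ i j t₀) ∧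
      ε₀ ∈ Ioo (0 : ℝ) 1 := by
    have h1 : ∀ᶠ ε₀ in 𝓝[>] (0 : ℝ), ∀ i j, G.Adj i j →
        |x j t₀ - x i t₀| ≤ (1 - ε₀) * ψ i j t₀ := by
      refine eventually_all.2 fun i => eventually_all.2 fun j => ?_
      by_cases hij : G.Adj i j
      · have hc : Tendsto (fun e : ℝ => (1 - e) * ψ i j t₀) (𝓝[>] 0) (𝓝 ((1 - 0) * ψ i j t₀)) :=
          (Continuous.tendsto (by fun_prop) 0).mono_left nhdsWithin_le_nhds
        have hlt := hin i j hij t₀ le_rfl hω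
        rw [sub_zero, one_mul] at hc
        filter_upwards [hc.eventually (lt_mem_nhds hlt)] with e he _ using he.le
      · exact Eventually.of_forall fun _ h => absurd h hij
    exact (h1.and (Ioo_mem_nhdsGT zero_lt_one)).exists
  set N := Fintype.card V with hN
  -- With `R = C + N B + 1 + 2 N K` the couplings drive a contact difference at a rate of at most
  -- `-(C + N B) - 1`. This absorbs the drift `C` and the rate `N B` at which `θ` may shrink, with
  -- `1` to spare for strictness.
  obtain ⟨ε, hε, hεK⟩ := exists_threshold_scale (ι := {q : V × V // G.Adj q.1 q.2})
    (μ := fun q => μ q.1.1 q.1.2) (fun q => hμc _ _ q.2) (fun q => hμr _ _ q.2)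
    (fun q => hμl _ _ q.2) (C + N * B + 1) (2 * N) N hε₀
  have hε1 : ∀ h, ε h ∈ Ioo (0 : ℝ) 1 := fun h => ⟨(hε h).1, (hε h).2.trans_lt hε₀.2⟩
  have hmem : ∀ i j, G.Adj i j → ∀ t, t₀ ≤ t → (t : EReal) < ω →
      (x j t - x i t) / ψ i j t ∈ Ioo (-1 : ℝ) 1 := by
    intro i j hij t h1 h2
    have hpos := hψ i j hij t h1
    rw [mem_Ioo, ← abs_lt, abs_div, abs_of_pos hpos, div_lt_one hpos]
    exact hin i j hij t h1 h2
  -- Induction along the interval, with all trees and pairs treated together: the contact analysis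
  -- for one tree uses the inequalities of its neighbours.
  have main : ∀ T, t₀ ≤ T → (T : EReal) < ω → ∀ U θ, FunnelTree G ψ ε U θ →
      ∀ a ∈ U, ∀ b ∈ U, x a T - x b T ≤ θ T := by
    intro T hT hTω
    have hlt : ∀ t ∈ Icc t₀ T, (t : EReal) < ω := fun t ht =>
      lt_of_le_of_lt (EReal.coe_le_coe ht.2) hTω
    have hxc : ∀ i, ContinuousOn (x i) (Icc t₀ T) := fun i => (hx i).continuousOn hT hTω
    have hψc : ∀ i j, G.Adj i j → ContinuousOn (ψ i j) (Icc t₀ T) := fun i j hij =>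
      (hlip i j hij).continuousOn.mono Icc_subset_Ici_self
    let S : Set ℝ := {t | ∀ U θ, FunnelTree G ψ ε U θ → ∀ a ∈ U, ∀ b ∈ U, x a t - x b t ≤ θ t}
    have hcl : IsClosed (S ∩ Icc t₀ T) := by
      have : S ∩ Icc t₀ T = Icc t₀ T ∩ ⋂ (U : Finset V) (θ : ℝ → ℝ) (_ : FunnelTree G ψ ε U θ)
          (a ∈ U) (b ∈ U), {t ∈ Icc t₀ T | x a t - x b t ≤ θ t} := by
        ext t
        simp only [S, mem_inter_iff, mem_ofPred_eq, mem_iInter]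
        constructor
        · exact fun h => ⟨h.2, fun U θ hU a ha b hb => ⟨h.2, h.1 U θ hU a ha b hb⟩⟩
        · exact fun h => ⟨fun U θ hU a ha b hb => (h.2 U θ hU a ha b hb).2, h.1⟩
      rw [this]
      refine isClosed_Icc.inter (isClosed_iInter fun U => isClosed_iInter fun θ =>
        isClosed_iInter fun hU => isClosed_iInter fun a => isClosed_iInter fun _ =>
        isClosed_iInter fun b => isClosed_iInter fun _ => ?_)
      exact isClosed_Icc.isClosed_le ((hxc a).sub (hxc b)) (hU.continuousOn hψc)
    have h0 : t₀ ∈ S := fun U θ hU => hU.sub_le_of_margin hε hε₀.2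
      (fun i j hij => hψ i j hij t₀ le_rfl) hε₀x
    have hstep : ∀ t ∈ S ∩ Ico t₀ T, ∀ y ∈ Ioi t, (S ∩ Ioc t y).Nonempty := by
      rintro t ⟨htS, ht⟩ y hy
      have htI : t ∈ Icc t₀ T := Ico_subset_Icc_self ht
      have hnhds : 𝓝[>] t ≤ 𝓝[Icc t₀ T] t := by
        rw [← nhdsWithin_Ioo_eq_nhdsGT ht.2]
        exact nhdsWithin_mono _ fun s hs => ⟨ht.1.trans hs.1.le, hs.2.le⟩
      have hev : ∀ᶠ s in 𝓝[>] t, ∀ q ∈ {q : Finset V × (ℝ → ℝ) | FunnelTree G ψ ε q.1 q.2},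
          ∀ a ∈ q.1, ∀ b ∈ q.1, x a s - x b s ≤ q.2 s := by
        refine (eventually_all_finite FunnelTree.finite).2 fun q hq =>
          (Finset.eventually_all q.1).2 fun a ha => (Finset.eventually_all q.1).2 fun b hb => ?_
        have hq' : FunnelTree G ψ ε q.1 q.2 := hq
        have hsub : ∀ᶠ s in 𝓝[>] t, s ∈ Ioo t T := Ioo_mem_nhdsGT ht.2
        rcases (htS q.1 q.2 hq a ha b hb).lt_or_eq with hlt' | heq
        · have hc1 := (((hxc a).sub (hxc b)) t htI).tendsto.mono_left hnhds
          have hc2 := (hq'.continuousOn hψc t htI).tendsto.mono_left hnhds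
          filter_upwards [hc1.eventually_lt hc2 hlt'] with s hs using hs.le
        · by_cases hab : a = b
          · filter_upwards [hsub] with s hs
            rw [hab, sub_self]
            exact hq'.nonneg hε1 fun i j hij => hψ i j hij s (ht.1.trans hs.1.le)
          obtain ⟨K, hK0, hK1, hK2, hR1, hR2⟩ := hεK q.1.card (Finset.card_le_univ _)
          have hle := hq'.coupling_sub_le (x := fun i => x i t) hε1
            (fun i j hij => hψ i j hij t ht.1) (fun i j hij => hsymm i j hij t ht.1)
            (fun i j hij => hin i j hij t ht.1 (hlt t htI)) htS ha hb hab heq hK0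
            (fun i j hij => hK1 ⟨(i, j), hij⟩) (fun i j hij => hK2 ⟨(i, j), hij⟩)
            (fun i j hij => hR1 ⟨(i, j), hij⟩) (fun i j hij => hR2 ⟨(i, j), hij⟩)
          -- The uncoupled parts `f` need not be continuous and the equation holds only a.e., so
          -- strictness at `t` is propagated through the continuous coupling sums and then
          -- integrated.
          have hΦ : ∀ i, ContinuousOn
              (fun s => ∑ j with G.Adj i j, μ i j ((x j s - x i s) / ψ i j s)) (Icc t₀ T) := by
            intro i
            refine continuousOn_finsetSum _ fun j hj => ?_
            have hij := (Finset.mem_filter.1 hj).2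
            exact (hμc i j hij).comp (((hxc j).sub (hxc i)).div (hψc i j hij)
              fun s hs => (hψ i j hij s hs.1).ne') fun s hs => hmem i j hij s hs.1 (hlt s hs)
          have hct := (((hΦ a).sub (hΦ b)) t htI).tendsto.mono_left hnhds
          have hev2 := hct.eventually (gt_mem_nhds (show _ < -(C + N * B) by
            refine lt_of_le_of_lt hle ?_
            linarith))
          obtain ⟨u, hu, hu'⟩ := mem_nhdsGT_iff_exists_Ioo_subset.1 (hev2.and hsub)
          filter_upwards [Ioo_mem_nhdsGT hu] with s hs
          have hsT : s ∈ Ioo t T := (hu' hs).2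
          have hs0 : t₀ ≤ s := ht.1.trans hs.1.le
          have hd := ((hx a).sub (hx b)).sub_le_mul (c := -(N * B)) ht.1 hs.1.le
            (hlt s ⟨hs0, hsT.2.le⟩) (fun r hr => by
              have h1 := (hu' ⟨hr.1, hr.2.trans hs.2⟩).1
              have h2 := hf a b r (ht.1.trans hr.1.le)
                (hlt r ⟨ht.1.trans hr.1.le, (hr.2.trans hsT.2).le⟩)
              simp only [Pi.sub_apply] at h1
              linarith)
          have hθ := hq'.sub_le (B := B) hε1 hs.1.le (NNReal.coe_nonneg B) fun i j hij => by
            have := (hlip i j hij).dist_le_mul t ht.1 s hs0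
            rw [Real.dist_eq, dist_comm, Real.dist_eq, abs_of_nonneg (sub_nonneg.2 hs.1.le)] at this
            exact (le_abs_self _).trans this
          have hcard : (q.1.card : ℝ) ≤ N := by exact_mod_cast Finset.card_le_univ _
          have := mul_le_mul_of_nonneg_right hcard
            (mul_nonneg (NNReal.coe_nonneg B) (sub_nonneg.2 hs.1.le))
          linarith
      obtain ⟨s, hs1, hs2⟩ := (hev.and (Ioc_mem_nhdsGT hy)).exists
      exact ⟨s, fun U θ hU => hs1 (U, θ) hU, hs2⟩
    exact hcl.Icc_subset_of_forall_exists_gt h0 hstep (right_mem_Icc.2 hT)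
  -- An edge is a tree whose second vertex carries the factor `1 - ε 2`.
  refine ⟨ε 2, hε1 2, fun i j hij t ht htω => ?_⟩
  have htree : ∀ i j, G.Adj i j → x j t - x i t ≤ (1 - ε 2) * ψ i j t := by
    intro i j hij
    have := main t ht htω _ _ ((FunnelTree.single (G := G) (ψ := ψ) (ε := ε) j).attach
      (Finset.mem_singleton_self j) (by simpa using hij.ne) hij) j
      (Finset.mem_insert_of_mem (Finset.mem_singleton_self j)) i (Finset.mem_insert_self _ _)
    simpa using this
  rw [abs_le]
  refine ⟨?_, htree i j hij⟩
  have := htree j i hij.symm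
  rw [← hsymm i j hij t ht] at this
  linarith

end FunnelMargin

/-! ### Changing, exhausting and gluing Carathéodory solutions. -/

theorem AbsolutelyContinuousOnInterval.congr {X : Type*} [PseudoMetricSpace X] {f g : ℝ → X}
    {a b : ℝ} (hf : AbsolutelyContinuousOnInterval f a b) (h : EqOn f g (uIcc a b)) :
    AbsolutelyContinuousOnInterval g a b := by
  rw [absolutelyContinuousOnInterval_iff] at hf ⊢
  intro ε hε
  obtain ⟨δ, hδ, H⟩ := hf ε hε
  refine ⟨δ, hδ, fun E hE hE' => ?_⟩
  refine lt_of_eq_of_lt (Finset.sum_congr rfl fun i hi => ?_) (H E hE hE')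
  have := hE.1 i hi
  rw [h this.1, h this.2]

namespace HasCaratheodoryDeriv

variable {E : Type*} [NormedAddCommGroup E] [NormedSpace ℝ E] {t₀ : ℝ} {ω : EReal} {x v : ℝ → E}

theorem congr {x' v' : ℝ → E} (h : HasCaratheodoryDeriv t₀ ω x v)
    (hx : ∀ t : ℝ, t₀ ≤ t → (t : EReal) < ω → x t = x' t)
    (hv : ∀ t : ℝ, t₀ < t → (t : EReal) < ω → v t = v' t) :
    HasCaratheodoryDeriv t₀ ω x' v' := by
  refine ⟨fun T h1 h2 => (h.1 T h1 h2).congr fun t ht => ?_, ?_⟩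
  · rw [uIcc_of_le h1] at ht
    exact hx t ht.1 (lt_of_le_of_lt (EReal.coe_le_coe ht.2) h2)
  · filter_upwards [h.2] with t ht h1 h2
    rw [← hv t h1 h2]
    refine (ht h1 h2).congr_of_eventuallyEq ?_
    filter_upwards [Ioi_mem_nhds h1, continuous_coe_real_ereal.tendsto t (Iio_mem_nhds h2)]
      with s hs1 hs2
    exact (hx s (le_of_lt hs1) hs2).symm

/-- Countability is essential: the exceptional null sets of all the restrictions are united. -/
theorem of_seq {u : ℕ → EReal} (h : ∀ n, HasCaratheodoryDeriv t₀ (u n) x v)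
    (hu : ∀ t : ℝ, (t : EReal) < ω → ∃ n, (t : EReal) < u n) : HasCaratheodoryDeriv t₀ ω x v := by
  refine ⟨fun T h1 h2 => ?_, ?_⟩
  · obtain ⟨n, hn⟩ := hu T h2
    exact (h n).1 T h1 hn
  · filter_upwards [ae_all_iff.2 fun n => (h n).2] with t ht h1 h2
    obtain ⟨n, hn⟩ := hu t h2
    exact ht n h1 hn

/-- A Lipschitz solution on `[t₀, a)` continued by a Lipschitz solution on `[a, b)`. -/
theorem of_lipschitz_piecewise {x₁ x₂ v₁ v₂ : ℝ → E} {K : NNReal} {a b : ℝ}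
    (h₁ : LipschitzOnWith K x₁ (Icc t₀ a)) (h₂ : LipschitzOnWith K x₂ (Icc a b))
    (ha : x₁ a = x₂ a) (hd₁ : ∀ᵐ t, t₀ < t → t < a → HasDerivAt x₁ (v₁ t) t)
    (hd₂ : ∀ᵐ t, t ∈ Ioo a b → HasDerivAt x₂ (v₂ t) t) :
    HasCaratheodoryDeriv t₀ b (fun t => if t < a then x₁ t else x₂ t)
      (fun t => if t < a then v₁ t else v₂ t) := by
  refine ⟨fun T h1 h2 => ?_, ?_⟩
  · refine LipschitzOnWith.absolutelyContinuousOnInterval (K := K)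
      ((h₁.piecewise_Icc h₂ ha).mono ?_)
    rw [uIcc_of_le h1]
    exact Icc_subset_Icc_right (EReal.coe_lt_coe_iff.1 h2).le
  · have hne : ∀ᵐ t : ℝ, t ≠ a := by simp [ae_iff, measure_singleton]
    filter_upwards [hd₁, hd₂, hne] with t h1 h2 h3 h4 h5
    rcases lt_or_gt_of_ne h3 with h | h
    · simp only [h, if_true]
      refine (h1 h4 h).congr_of_eventuallyEq ?_
      filter_upwards [Iio_mem_nhds h] with s hs
      simp only [mem_Iio.1 hs, if_true]
    · simp only [not_lt.2 h.le, if_false]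
      refine (h2 ⟨h, EReal.coe_lt_coe_iff.1 h5⟩).congr_of_eventuallyEq ?_
      filter_upwards [Ioi_mem_nhds h] with s hs
      simp only [not_lt.2 (mem_Ioi.1 hs).le, if_false]

end HasCaratheodoryDeriv

/-- At a fixed time the Lipschitz constant is just a number, so each time slice is continuous at
every point. -/
theorem IsCaratheodoryField.continuous {X E : Type*} [NormedAddCommGroup X]
    [NormedAddCommGroup E] {t₀ : ℝ} {f : ℝ → X → E} (h : IsCaratheodoryField t₀ f) {t : ℝ}
    (ht : t₀ ≤ t) : Continuous (f t) := by
  rw [continuous_iff_continuousAt]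
  intro x₀
  obtain ⟨U, hU, L, -, hL⟩ := h.locallyLipschitz x₀
  rw [ContinuousAt, tendsto_iff_norm_sub_tendsto_zero]
  have h0 : Tendsto (fun x => L t * ‖x - x₀‖) (𝓝 x₀) (𝓝 0) := by
    have : Continuous fun x => L t * ‖x - x₀‖ := by fun_prop
    simpa using this.tendsto x₀
  refine squeeze_zero' (Eventually.of_forall fun x => norm_nonneg _) ?_ h0
  filter_upwards [hU] with x hx
  exact hL t ht x hx x₀ (mem_of_mem_nhds hU)

/-! ### Local solvability of the closed loop by clamping. -/

section Clamp

/-- Componentwise projection onto `[-R, R]`. -/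
noncomputable def clampVec {ι : Type*} (R : ℝ) (v : ι → ℝ) : ι → ℝ := fun p => max (-R) (min R (v p))

theorem continuous_clampVec {ι : Type*} (R : ℝ) : Continuous (clampVec R : (ι → ℝ) → ι → ℝ) :=
  continuous_pi fun p => continuous_const.max (continuous_const.min (continuous_apply p))

theorem abs_clamp_le {R : ℝ} (hR : 0 ≤ R) (s : ℝ) : |max (-R) (min R s)| ≤ R :=
  abs_le.2 ⟨le_max_left _ _, max_le (by linarith) (min_le_left _ _)⟩

theorem clamp_of_abs_le {R s : ℝ} (hs : |s| ≤ R) : max (-R) (min R s) = s := by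
  rw [min_eq_right (abs_le.1 hs).2, max_eq_right (abs_le.1 hs).1]

theorem norm_clampVec_le {ι : Type*} [Fintype ι] {R : ℝ} (hR : 0 ≤ R) (v : ι → ℝ) : ‖clampVec R v‖ ≤ R :=
  (pi_norm_le_iff_of_nonneg hR).2 fun p => abs_clamp_le hR (v p)

theorem clampVec_of_norm_le {ι : Type*} [Fintype ι] {R : ℝ} {v : ι → ℝ} (hv : ‖v‖ ≤ R) : clampVec R v = v :=
  funext fun p => clamp_of_abs_le ((norm_le_pi_norm v p).trans hv)

end Clamp

namespace FunnelCoupling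

variable {N m : ℕ} {c : FunnelCoupling N m} {t₀ : ℝ}

theorem IsAdmissible.lipschitz (hc : c.IsAdmissible t₀) : ∃ B : NNReal, ∀ i j, c.graph.Adj i j →
    ∀ p, LipschitzOnWith B (c.ψ i j p) (Ici t₀) := by
  have h : ∀ i j p, ∀ᶠ B : NNReal in atTop, c.graph.Adj i j →
      LipschitzOnWith B (c.ψ i j p) (Ici t₀) := by
    intro i j p
    by_cases hij : c.graph.Adj i j
    · obtain ⟨b, hb⟩ := hc.ψ_deriv_bounded i j hij p
      filter_upwards [eventually_ge_atTop b.toNNReal] with B hB _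
      refine Convex.lipschitzOnWith_of_nnnorm_derivWithin_le (𝕜 := ℝ) (convex_Ici t₀)
        ((hc.ψ_contDiff i j hij p).differentiableOn one_ne_zero) fun t ht => ?_
      rw [← NNReal.coe_le_coe, coe_nnnorm, Real.norm_eq_abs]
      exact ((hb t ht).trans (Real.le_coe_toNNReal b)).trans (NNReal.coe_le_coe.2 hB)
    · exact Eventually.of_forall fun _ h => absurd h hij
  obtain ⟨B, hB⟩ := (eventually_all.2 fun i => eventually_all.2 fun j =>
    eventually_all.2 fun p => h i j p).exists
  exact ⟨B, fun i j hij p => hB i j p hij⟩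

theorem IsAdmissible.continuousOn (hc : c.IsAdmissible t₀) {i j : Fin N} (hij : c.graph.Adj i j)
    (p : Fin m) : ContinuousOn (c.ψ i j p) (Ici t₀) :=
  (hc.ψ_contDiff i j hij p).continuousOn

/-- Within a fixed relative distance from the funnel boundary the couplings are bounded. -/
theorem IsAdmissible.exists_coupling_bound (hc : c.IsAdmissible t₀) {ε : ℝ} (hε : 0 < ε) :
    ∃ K, 0 ≤ K ∧ ∀ i j, c.graph.Adj i j → ∀ p s, |s| ≤ 1 - ε → |c.μ i j p s| ≤ K := by
  have h : ∀ i j p, ∀ᶠ K : ℝ in atTop, c.graph.Adj i j → ∀ s, |s| ≤ 1 - ε → |c.μ i j p s| ≤ K := by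
    intro i j p
    by_cases hij : c.graph.Adj i j
    · obtain ⟨A, hA⟩ := (isCompact_Icc (a := -(1 - ε)) (b := 1 - ε)).exists_bound_of_continuousOn
        ((hc.μ_cont i j hij p).mono fun s hs => ⟨by linarith [hs.1], by linarith [hs.2]⟩)
      filter_upwards [eventually_ge_atTop A] with K hK _ s hs
      exact (hA s (abs_le.1 hs)).trans hK
    · exact Eventually.of_forall fun _ h => absurd h hij
  obtain ⟨K, hK, hK0⟩ := ((eventually_all.2 fun i => eventually_all.2 fun j =>
    eventually_all.2 fun p => h i j p).and (eventually_ge_atTop 0)).exists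
  exact ⟨K, hK0, fun i j hij p => hK i j p hij⟩

theorem edgeSum_apply (i : Fin N) (t : ℝ) (y : Fin N → Fin m → ℝ) (p : Fin m)
    [DecidableRel c.graph.Adj] :
    c.edgeSum i t y p = ∑ j with c.graph.Adj i j, c.μ i j p ((y j p - y i p) / c.ψ i j p t) := by
  rw [edgeSum, Finset.sum_apply]
  congr!

theorem norm_edgeSum_le {i : Fin N} {t K : ℝ} {y : Fin N → Fin m → ℝ} (hK : 0 ≤ K)
    (h : ∀ j, c.graph.Adj i j → ∀ p, |c.μ i j p ((y j p - y i p) / c.ψ i j p t)| ≤ K) :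
    ‖c.edgeSum i t y‖ ≤ N * K := by
  classical
  refine (pi_norm_le_iff_of_nonneg (by positivity)).2 fun p => ?_
  rw [edgeSum_apply, Real.norm_eq_abs]
  refine (Finset.abs_sum_le_sum_abs _ _).trans (Finset.sum_le_card_mul hK (fun j hj => ?_)
    ((Finset.card_le_univ _).trans_eq (Fintype.card_fin N)))
  exact h j (Finset.mem_filter.1 hj).2 p

theorem abs_div_le_of_margin {a b ε : ℝ} (hb : 0 < b) (h : |a| ≤ (1 - ε) * b) :
    |a / b| ≤ 1 - ε := by
  rwa [abs_div, abs_of_pos hb, div_le_iff₀ hb]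

/-- A configuration inside the funnel is inside a slightly smaller funnel. -/
theorem InFunnel.exists_margin {t : ℝ}
    {y : Fin N → Fin m → ℝ} (hy : c.InFunnel t y) : ∃ ε ∈ Ioo (0 : ℝ) 1,
      ∀ i j, c.graph.Adj i j → ∀ p, |y j p - y i p| < (1 - ε) * c.ψ i j p t := by
  have h1 : ∀ᶠ ε in 𝓝[>] (0 : ℝ), ∀ i j p, c.graph.Adj i j →
      |y j p - y i p| < (1 - ε) * c.ψ i j p t := by
    refine eventually_all.2 fun i => eventually_all.2 fun j => eventually_all.2 fun p => ?_
    by_cases hij : c.graph.Adj i j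
    · have h2 : Tendsto (fun e : ℝ => (1 - e) * c.ψ i j p t) (𝓝[>] 0)
          (𝓝 ((1 - 0) * c.ψ i j p t)) :=
        (Continuous.tendsto (by fun_prop) 0).mono_left nhdsWithin_le_nhds
      rw [sub_zero, one_mul] at h2
      filter_upwards [h2.eventually (lt_mem_nhds (hy i j hij p))] with e he _ using he
    · exact Eventually.of_forall fun _ h => absurd h hij
  obtain ⟨ε, hε, hε'⟩ := (h1.and (Ioo_mem_nhdsGT zero_lt_one)).exists
  exact ⟨ε, hε', fun i j hij p => hε i j p hij⟩

end FunnelCoupling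

namespace AgentNetwork

variable {N m : ℕ} {n k : Fin N → ℕ} {S : AgentNetwork N m n k} {c : FunnelCoupling N m}

/-- The gain cancels against its inverse, so the outputs are driven by the bare coupling sum. -/
theorem mulVec_input (hgain : S.HasBoundedInverseGain) {t : ℝ} (ht : S.t₀ ≤ t) (i : Fin N)
    (y : Fin N → Fin m → ℝ) (z : (i : Fin N) → Fin (n i) → ℝ) :
    (S.Γ i t (S.W i (y i) (z i))).mulVec (S.input c i t y z) = c.edgeSum i t y := by
  rw [input, Matrix.mulVec_mulVec, Matrix.mul_nonsing_inv, Matrix.one_mulVec]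
  exact (Matrix.isUnit_iff_isUnit_det _).1 (hgain.1 i t _ ht)

theorem IsSolution.y_deriv_edgeSum {ω : EReal} {y : ℝ → Fin N → Fin m → ℝ}
    {z : ℝ → (i : Fin N) → Fin (n i) → ℝ} (h : S.IsSolution c ω y z)
    (hgain : S.HasBoundedInverseGain) (i : Fin N) :
    HasCaratheodoryDeriv S.t₀ ω (fun t => y t i)
      (fun t => S.F i t (y t i) (z t i) + c.edgeSum i t (y t)) :=
  (h.y_deriv i).congr_deriv fun t h1 _ => by rw [mulVec_input hgain h1.le]

/-- The fields `F i` and `Z i` are bounded on bounded sets, by a common constant. -/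
theorem IsRegular.exists_bound (hreg : S.IsRegular) (R : ℝ) : ∃ M : ℝ, 0 ≤ M ∧
    ∀ i t y z, S.t₀ ≤ t → ‖y‖ ≤ R → ‖z‖ ≤ R → ‖S.F i t y z‖ ≤ M ∧ ‖S.Z i t z y‖ ≤ M := by
  have h : ∀ i, ∀ᶠ M : ℝ in atTop, ∀ t y z, S.t₀ ≤ t → ‖y‖ ≤ R → ‖z‖ ≤ R →
      ‖S.F i t y z‖ ≤ M ∧ ‖S.Z i t z y‖ ≤ M := by
    intro i
    have hK := isCompact_closedBall (0 : (Fin m → ℝ) × (Fin (n i) → ℝ)) R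
    obtain ⟨A, hA⟩ := (hreg.F_field i).bounded _ hK
    obtain ⟨B, hB⟩ := (hreg.Z_field i).bounded _ hK
    filter_upwards [eventually_ge_atTop A, eventually_ge_atTop B] with M h1 h2 t y z ht hy hz
    have hmem : (y, z) ∈ Metric.closedBall (0 : (Fin m → ℝ) × (Fin (n i) → ℝ)) R := by
      rw [mem_closedBall_zero_iff]
      exact max_le hy hz
    exact ⟨(hA t ht _ hmem).trans h1, (hB t ht _ hmem).trans h2⟩
  obtain ⟨M, hM, hM0⟩ := ((eventually_all.2 h).and (eventually_ge_atTop 0)).exists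
  exact ⟨M, hM0, hM⟩

/-- The closed loop with the states clamped to `[-R, R]` and the arguments of the couplings
clamped to `[-(1 - ε), 1 - ε]`, switched on at time `a`. -/
noncomputable def clampedField (S : AgentNetwork N m n k) (c : FunnelCoupling N m) (a R ε : ℝ)
    (t : ℝ) (x : (Fin N → Fin m → ℝ) × ((i : Fin N) → Fin (n i) → ℝ)) :
    (Fin N → Fin m → ℝ) × ((i : Fin N) → Fin (n i) → ℝ) :=
  (Ici a).indicator (fun t =>
    (fun i p => S.F i t (clampVec R (x.1 i)) (clampVec R (x.2 i)) p +
        (open Classical in ∑ j with c.graph.Adj i j,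
          c.μ i j p (max (-(1 - ε)) (min (1 - ε) ((x.1 j p - x.1 i p) / c.ψ i j p t)))),
      fun i => S.Z i t (clampVec R (x.2 i)) (clampVec R (x.1 i)))) t

theorem clampedField_measurable (hreg : S.IsRegular) (hc : c.IsAdmissible S.t₀) {a R ε : ℝ}
    (ha : S.t₀ ≤ a) (hε : ε ∈ Ioo (0 : ℝ) 1)
    (x : (Fin N → Fin m → ℝ) × ((i : Fin N) → Fin (n i) → ℝ)) :
    AEStronglyMeasurable (fun t => S.clampedField c a R ε t x) volume := by
  classical
  have hle : volume.restrict (Ici a) ≤ volume.restrict (Ici S.t₀) :=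
    Measure.restrict_mono (Ici_subset_Ici.2 ha) le_rfl
  refine (aestronglyMeasurable_indicator_iff measurableSet_Ici).2
    (AEStronglyMeasurable.prodMk ?_ ?_)
  · refine AEMeasurable.aestronglyMeasurable (aemeasurable_pi_iff.2 fun i =>
      aemeasurable_pi_iff.2 fun p => ?_)
    refine AEMeasurable.add ?_ ?_
    · have := ((hreg.F_field i).measurable
        (clampVec R (x.1 i), clampVec R (x.2 i))).mono_measure hle
      exact aemeasurable_pi_iff.1 this.aemeasurable p
    · refine Finset.aemeasurable_fun_sum _ fun j hj => ?_
      have hij := (Finset.mem_filter.1 hj).2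
      refine ContinuousOn.aemeasurable ?_ measurableSet_Ici
      refine (hc.μ_cont i j hij p).comp ?_ fun t _ => ?_
      · refine (continuous_const.max (continuous_const.min continuous_id)).comp_continuousOn
          (continuousOn_const.div ((hc.continuousOn hij p).mono (Ici_subset_Ici.2 ha))
            fun t ht => ?_)
        exact (hc.ψ_pos i j hij p t (ha.trans ht)).ne'
      · have := abs_le.1 (abs_clamp_le (sub_nonneg.2 hε.2.le)
          ((x.1 j p - x.1 i p) / c.ψ i j p t))
        exact ⟨by linarith [this.1, hε.1], by linarith [this.2, hε.1]⟩
  · refine AEMeasurable.aestronglyMeasurable (aemeasurable_pi_iff.2 fun i => ?_)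
    exact (((hreg.Z_field i).measurable
        (clampVec R (x.1 i), clampVec R (x.2 i))).mono_measure hle).aemeasurable

theorem continuous_clampedField (hreg : S.IsRegular) (hc : c.IsAdmissible S.t₀) {a R ε : ℝ}
    (ha : S.t₀ ≤ a) (hε : ε ∈ Ioo (0 : ℝ) 1) (t : ℝ) :
    Continuous (S.clampedField c a R ε t) := by
  classical
  by_cases ht : t ∈ Ici a
  · have h0 : S.t₀ ≤ t := ha.trans ht
    unfold clampedField
    simp only [indicator_of_mem ht]
    refine Continuous.prodMk (continuous_pi fun i => continuous_pi fun p => ?_)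
      (continuous_pi fun i => ?_)
    · refine Continuous.add ?_ (continuous_finsetSum _ fun j hj => ?_)
      · exact (continuous_apply p).comp (((hreg.F_field i).continuous h0).comp
          (((continuous_clampVec R).comp ((continuous_apply i).comp continuous_fst)).prodMk
            ((continuous_clampVec R).comp ((continuous_apply i).comp continuous_snd))))
      · have hij := (Finset.mem_filter.1 hj).2
        refine (hc.μ_cont i j hij p).comp_continuous (by fun_prop) fun x => ?_
        have := abs_le.1 (abs_clamp_le (sub_nonneg.2 hε.2.le)
          ((x.1 j p - x.1 i p) / c.ψ i j p t))
        exact ⟨by linarith [this.1, hε.1], by linarith [this.2, hε.1]⟩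
    · exact ((hreg.Z_field i).continuous h0).comp
          (((continuous_clampVec R).comp ((continuous_apply i).comp continuous_fst)).prodMk
            ((continuous_clampVec R).comp ((continuous_apply i).comp continuous_snd)))
  · unfold clampedField
    simp only [indicator_of_notMem ht]
    exact continuous_const

theorem exists_clampedField_bound (hreg : S.IsRegular) (hc : c.IsAdmissible S.t₀) {a R ε : ℝ}
    (ha : S.t₀ ≤ a) (hR : 0 ≤ R) (hε : ε ∈ Ioo (0 : ℝ) 1) :
    ∃ M : NNReal, ∀ t x, ‖S.clampedField c a R ε t x‖ ≤ M := by
  classical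
  obtain ⟨A, hA0, hA⟩ := hreg.exists_bound R
  obtain ⟨K, hK0, hK⟩ := hc.exists_coupling_bound hε.1
  have hM0 : 0 ≤ A + N * K := by positivity
  refine ⟨⟨A + N * K, hM0⟩, fun t x => ?_⟩
  change _ ≤ A + N * K
  by_cases ht : t ∈ Ici a
  · unfold clampedField
    simp only [indicator_of_mem ht]
    refine max_le ((pi_norm_le_iff_of_nonneg hM0).2 fun i =>
      (pi_norm_le_iff_of_nonneg hM0).2 fun p => ?_) ((pi_norm_le_iff_of_nonneg hM0).2 fun i => ?_)
    · refine (norm_add_le _ _).trans (add_le_add ?_ ?_)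
      · exact (norm_le_pi_norm _ p).trans
          (hA i t _ _ (ha.trans ht) (norm_clampVec_le hR _) (norm_clampVec_le hR _)).1
      · rw [Real.norm_eq_abs]
        refine (Finset.abs_sum_le_sum_abs _ _).trans (Finset.sum_le_card_mul hK0 (fun j hj => ?_)
          ((Finset.card_le_univ _).trans_eq (Fintype.card_fin N)))
        exact hK i j (Finset.mem_filter.1 hj).2 p _ (abs_clamp_le (sub_nonneg.2 hε.2.le) _)
    · refine (hA i t _ _ (ha.trans ht) (norm_clampVec_le hR _) (norm_clampVec_le hR _)).2.trans ?_
      have : 0 ≤ (N : ℝ) * K := by positivity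
      linarith
  · unfold clampedField
    simp only [indicator_of_notMem ht, norm_zero]
    exact hM0

/-- Local solvability of the closed loop from any time and any state inside the funnel. -/
theorem exists_local_solution (hreg : S.IsRegular) (hc : c.IsAdmissible S.t₀) {a : ℝ}
    (ha : S.t₀ ≤ a) {y₁ : Fin N → Fin m → ℝ} (z₁ : (i : Fin N) → Fin (n i) → ℝ)
    (hy₁ : c.InFunnel a y₁) :
    ∃ b, a < b ∧ ∃ (K : NNReal) (y : ℝ → Fin N → Fin m → ℝ) (z : ℝ → (i : Fin N) → Fin (n i) → ℝ),
      y a = y₁ ∧ z a = z₁ ∧ LipschitzWith K y ∧ LipschitzWith K z ∧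
      (∀ t ∈ Icc a b, c.InFunnel t (y t)) ∧
      ∀ᵐ t, t ∈ Ioo a b →
        HasDerivAt y (fun i => S.F i t (y t i) (z t i) + c.edgeSum i t (y t)) t ∧
        HasDerivAt z (fun i => S.Z i t (z t i) (y t i)) t := by
  classical
  obtain ⟨ε, hε, hεy⟩ := hy₁.exists_margin
  -- Both clamps are strictly inactive at time `a`: the state norm is below `R` and the margin is
  -- strict. By continuity they stay inactive for a short time, where the clamped and true fields
  -- agree.
  set R : ℝ := ‖(y₁, z₁)‖ + 1 with hRdef
  have hR : 0 ≤ R := by positivity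
  obtain ⟨M, hM⟩ := exists_clampedField_bound (R := R) hreg hc ha hR hε
  obtain ⟨x, hxa, hxL, hxd⟩ := exists_caratheodory_solution
    (clampedField_measurable (R := R) hreg hc ha hε) (continuous_clampedField hreg hc ha hε)
    hM a (a + 1) (y₁, z₁)
  have hxc := hxL.continuous
  have hev1 : ∀ᶠ t in 𝓝[≥] a, ‖x t‖ < R := by
    refine (hxc.norm.tendsto a).mono_left nhdsWithin_le_nhds |>.eventually (gt_mem_nhds ?_)
    rw [hxa]
    exact lt_add_one _
  have hev2 : ∀ᶠ t in 𝓝[≥] a, ∀ i j p, c.graph.Adj i j →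
      |(x t).1 j p - (x t).1 i p| < (1 - ε) * c.ψ i j p t := by
    refine eventually_all.2 fun i => eventually_all.2 fun j => eventually_all.2 fun p => ?_
    by_cases hij : c.graph.Adj i j
    · have h1 : Tendsto (fun t => |(x t).1 j p - (x t).1 i p|) (𝓝[≥] a)
          (𝓝 (|(x a).1 j p - (x a).1 i p|)) :=
        (Continuous.tendsto (by fun_prop) a).mono_left nhdsWithin_le_nhds
      have h2 : Tendsto (fun t => (1 - ε) * c.ψ i j p t) (𝓝[≥] a) (𝓝 ((1 - ε) * c.ψ i j p a)) :=
        Tendsto.const_mul _ (((hc.continuousOn hij p).mono (Ici_subset_Ici.2 ha)) a self_mem_Ici)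
      filter_upwards [h1.eventually_lt h2 (by rw [hxa]; exact hεy i j hij p)] with t ht _ using ht
    · exact Eventually.of_forall fun _ h => absurd h hij
  have hev3 : ∀ᶠ t in 𝓝[≥] a, t < a + 1 :=
    mem_nhdsWithin_of_mem_nhds (Iio_mem_nhds (lt_add_one a))
  obtain ⟨b, hb, hab⟩ := mem_nhdsGE_iff_exists_Icc_subset.1 ((hev1.and hev2).and hev3)
  change a < b at hb
  refine ⟨b, hb, M, fun t => (x t).1, fun t => (x t).2, congrArg Prod.fst hxa,
    congrArg Prod.snd hxa, LipschitzWith.of_dist_le_mul fun s t => (le_max_left _ _).trans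
      (hxL.dist_le_mul s t), LipschitzWith.of_dist_le_mul fun s t => (le_max_right _ _).trans
      (hxL.dist_le_mul s t), ?_, ?_⟩
  · intro t ht i j hij p
    have h := (hab ht).1.2 i j p hij
    have hpos := hc.ψ_pos i j hij p t (ha.trans ht.1)
    have := mul_pos hε.1 hpos
    linarith
  · filter_upwards [hxd] with t ht htm
    obtain ⟨⟨hb1, hb2⟩, hb3⟩ := hab (Ioo_subset_Icc_self htm)
    have hd := ht ⟨htm.1, hb3⟩
    have hta : t ∈ Ici a := htm.1.le
    have hy : ∀ i, ‖(x t).1 i‖ ≤ R := fun i =>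
      (norm_le_pi_norm (x t).1 i).trans ((norm_fst_le (x t)).trans hb1.le)
    have hz : ∀ i, ‖(x t).2 i‖ ≤ R := fun i =>
      (norm_le_pi_norm (x t).2 i).trans ((norm_snd_le (x t)).trans hb1.le)
    have e : S.clampedField c a R ε t (x t) =
        (fun i => S.F i t ((x t).1 i) ((x t).2 i) + c.edgeSum i t (x t).1,
          fun i => S.Z i t ((x t).2 i) ((x t).1 i)) := by
      unfold clampedField
      rw [indicator_of_mem hta]
      simp only [clampVec_of_norm_le (hy _), clampVec_of_norm_le (hz _)]
      refine Prod.ext (funext fun i => funext fun p => ?_) rfl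
      simp only [Pi.add_apply, FunnelCoupling.edgeSum_apply]
      congr 1
      refine Finset.sum_congr (by congr!) fun j hj => ?_
      have hij := (Finset.mem_filter.1 hj).2
      rw [clamp_of_abs_le (FunnelCoupling.abs_div_le_of_margin
        (hc.ψ_pos i j hij p t (ha.trans hta)) (hb2 i j p hij).le)]
    rw [e] at hd
    exact ⟨(ContinuousLinearMap.fst ℝ (Fin N → Fin m → ℝ)
        ((i : Fin N) → Fin (n i) → ℝ)).hasFDerivAt.comp_hasDerivAt t hd,
      (ContinuousLinearMap.snd ℝ (Fin N → Fin m → ℝ)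
        ((i : Fin N) → Fin (n i) → ℝ)).hasFDerivAt.comp_hasDerivAt t hd⟩

end AgentNetwork

/-! ### Continuation and maximal solutions. -/

namespace AgentNetwork

variable {N m : ℕ} {n k : Fin N → ℕ} {S : AgentNetwork N m n k} {c : FunnelCoupling N m}

/-- A Lipschitz solution on `[t₀, a]` inside the funnel extends beyond `a`. -/
theorem exists_continuation (hreg : S.IsRegular) (hgain : S.HasBoundedInverseGain)
    (hc : c.IsAdmissible S.t₀) {a : ℝ} (ha : S.t₀ ≤ a) {y : ℝ → Fin N → Fin m → ℝ}
    {z : ℝ → (i : Fin N) → Fin (n i) → ℝ} {K : NNReal} (hy : LipschitzOnWith K y (Icc S.t₀ a))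
    (hz : LipschitzOnWith K z (Icc S.t₀ a)) (hin : ∀ t ∈ Icc S.t₀ a, c.InFunnel t (y t))
    (hd : ∀ i, ∀ᵐ t, S.t₀ < t → t < a →
      HasDerivAt (fun t => y t i) (S.F i t (y t i) (z t i) + c.edgeSum i t (y t)) t ∧
        HasDerivAt (fun t => z t i) (S.Z i t (z t i) (y t i)) t) :
    ∃ b : ℝ, a < b ∧ ∃ (y' : ℝ → Fin N → Fin m → ℝ) (z' : ℝ → (i : Fin N) → Fin (n i) → ℝ),
      S.IsSolution c b y' z' ∧ ∀ t ∈ Icc S.t₀ a, y' t = y t ∧ z' t = z t := by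
  obtain ⟨b, hab, K', y₂, z₂, hya, hza, hyL, hzL, hin₂, hd₂⟩ :=
    exists_local_solution hreg hc ha (z a) (hin a ⟨ha, le_rfl⟩)
  have hlip : ∀ {ι : Type} [Fintype ι] {E : ι → Type} [∀ i, PseudoMetricSpace (E i)]
      {f : ℝ → ∀ i, E i} {s : Set ℝ} {L : NNReal}, LipschitzOnWith L f s → L ≤ max K K' → ∀ i,
      LipschitzOnWith (max K K') (fun t => f t i) s := by
    intro ι _ E _ f s L hf hL i
    refine LipschitzOnWith.of_dist_le_mul fun u hu v hv => ?_
    exact (dist_le_pi_dist (f u) (f v) i).trans ((hf.weaken hL).dist_le_mul u hu v hv)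
  have hyd : ∀ i, HasCaratheodoryDeriv S.t₀ b (fun t => if t < a then y t i else y₂ t i)
      (fun t => if t < a then S.F i t (y t i) (z t i) + c.edgeSum i t (y t) else
        S.F i t (y₂ t i) (z₂ t i) + c.edgeSum i t (y₂ t)) := by
    intro i
    refine HasCaratheodoryDeriv.of_lipschitz_piecewise (K := max K K')
      (hlip hy (le_max_left _ _) i) (hlip hyL.lipschitzOnWith (le_max_right _ _) i)
      (by rw [hya]) ?_ ?_
    · filter_upwards [hd i] with t ht h1 h2 using (ht h1 h2).1
    · filter_upwards [hd₂] with t ht htm using hasDerivAt_pi.1 (ht htm).1 i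
  have hzd : ∀ i, HasCaratheodoryDeriv S.t₀ b (fun t => if t < a then z t i else z₂ t i)
      (fun t => if t < a then S.Z i t (z t i) (y t i) else S.Z i t (z₂ t i) (y₂ t i)) := by
    intro i
    refine HasCaratheodoryDeriv.of_lipschitz_piecewise (K := max K K')
      (hlip hz (le_max_left _ _) i) (hlip hzL.lipschitzOnWith (le_max_right _ _) i)
      (by rw [hza]) ?_ ?_
    · filter_upwards [hd i] with t ht h1 h2 using (ht h1 h2).2
    · filter_upwards [hd₂] with t ht htm using hasDerivAt_pi.1 (ht htm).2 i
  refine ⟨b, hab, fun t => if t < a then y t else y₂ t, fun t => if t < a then z t else z₂ t,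
    ⟨EReal.coe_lt_coe (ha.trans_lt hab), fun t h1 h2 => ?_, fun i => ?_, fun i => ?_⟩,
    fun t ht => ?_⟩
  · by_cases hta : t < a
    · simp only [hta, if_true]
      exact hin t ⟨h1, hta.le⟩
    · simp only [hta, if_false]
      exact hin₂ t ⟨not_lt.1 hta, (EReal.coe_lt_coe_iff.1 h2).le⟩
  · refine (hyd i).congr (fun t _ _ => ?_) (fun t h1 _ => ?_)
    · by_cases hta : t < a <;> simp only [hta, if_true, if_false]
    · rw [mulVec_input hgain h1.le]
      by_cases hta : t < a <;> simp only [hta, if_true, if_false]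
  · refine (hzd i).congr (fun t _ _ => ?_) (fun t h1 _ => ?_)
    · by_cases hta : t < a <;> simp only [hta, if_true, if_false]
    · by_cases hta : t < a <;> simp only [hta, if_true, if_false]
  · rcases ht.2.lt_or_eq with hta | rfl
    · simp only [hta, if_true, and_self]
    · simp only [lt_irrefl, if_false, hya, hza, and_self]

/-- A solution with values `y₀`, `z₀` at `t₀`, as a bundled triple `(ω, y, z)`. -/
abbrev SolutionFrom (S : AgentNetwork N m n k) (c : FunnelCoupling N m) (y₀ : Fin N → Fin m → ℝ)
    (z₀ : (i : Fin N) → Fin (n i) → ℝ) :=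
  {q : EReal × (ℝ → Fin N → Fin m → ℝ) × (ℝ → (i : Fin N) → Fin (n i) → ℝ) //
    S.IsSolution c q.1 q.2.1 q.2.2 ∧ q.2.1 S.t₀ = y₀ ∧ q.2.2 S.t₀ = z₀}

namespace SolutionFrom

variable {y₀ : Fin N → Fin m → ℝ} {z₀ : (i : Fin N) → Fin (n i) → ℝ}

/-- `q` extends `p`. -/
def Extends (p q : SolutionFrom S c y₀ z₀) : Prop :=
  p.1.1 ≤ q.1.1 ∧ ∀ t, S.t₀ ≤ t → (t : EReal) < p.1.1 →
    q.1.2.1 t = p.1.2.1 t ∧ q.1.2.2 t = p.1.2.2 t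

/-- At each time the bound takes the value of some chain member alive there; comparability makes the
choice immaterial. A sequence of members whose end times tend to the supremum transfers the
differential equation with countably many null sets. -/
theorem exists_extends_of_chain {C : Set (SolutionFrom S c y₀ z₀)} (hC : IsChain Extends C)
    (hne : C.Nonempty) : ∃ u : SolutionFrom S c y₀ z₀, ∀ p ∈ C, Extends p u := by
  classical
  set ω : EReal := sSup ((fun p : SolutionFrom S c y₀ z₀ => p.1.1) '' C) with hω
  have hle : ∀ p ∈ C, p.1.1 ≤ ω := fun p hp => le_sSup (mem_image_of_mem _ hp)
  have hex : ∀ t : ℝ, ∃ p ∈ C, (t : EReal) < ω → (t : EReal) < p.1.1 := by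
    intro t
    by_cases ht : (t : EReal) < ω
    · obtain ⟨_, ⟨p, hp, rfl⟩, htp⟩ := lt_sSup_iff.1 ht
      exact ⟨p, hp, fun _ => htp⟩
    · obtain ⟨p, hp⟩ := hne
      exact ⟨p, hp, fun h => absurd h ht⟩
  choose P hPC hP using hex
  have hagree : ∀ p ∈ C, ∀ t : ℝ, S.t₀ ≤ t → (t : EReal) < p.1.1 →
      (P t).1.2.1 t = p.1.2.1 t ∧ (P t).1.2.2 t = p.1.2.2 t := by
    intro p hp t h1 h2
    have h3 := hP t (h2.trans_le (hle p hp))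
    by_cases heq : p = P t
    · rw [← heq]; exact ⟨rfl, rfl⟩
    rcases hC hp (hPC t) heq with h | h
    · exact h.2 t h1 h2
    · exact ⟨(h.2 t h1 h3).1.symm, (h.2 t h1 h3).2.symm⟩
  obtain ⟨u, -, hu, huC⟩ := exists_seq_tendsto_sSup (hne.image fun p => p.1.1) (OrderTop.bddAbove _)
  choose A hAC hA using huC
  have hseq : ∀ t : ℝ, (t : EReal) < ω → ∃ j, (t : EReal) < u j := fun t ht =>
    (hu.eventually (lt_mem_nhds ht)).exists
  have hlt0 : ∀ p ∈ C, (S.t₀ : EReal) < p.1.1 := fun p _ => p.2.1.lt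
  obtain ⟨p₀, hp₀⟩ := hne
  refine ⟨⟨(ω, fun t => (P t).1.2.1 t, fun t => (P t).1.2.2 t),
    ⟨(hlt0 p₀ hp₀).trans_le (hle p₀ hp₀), fun t h1 h2 => ?_, fun i => ?_, fun i => ?_⟩, ?_, ?_⟩,
    fun p hp => ⟨hle p hp, hagree p hp⟩⟩
  · exact (P t).2.1.inFunnel t h1 (hP t h2)
  · refine HasCaratheodoryDeriv.of_seq (u := u) (fun j => ?_) hseq
    rw [← hA j]
    refine ((A j).2.1.y_deriv i).congr (fun t h1 h2 => ?_) fun t h1 h2 => ?_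
    · simp only [(hagree _ (hAC j) t h1 h2).1]
    · simp only [(hagree _ (hAC j) t h1.le h2).1, (hagree _ (hAC j) t h1.le h2).2]
  · refine HasCaratheodoryDeriv.of_seq (u := u) (fun j => ?_) hseq
    rw [← hA j]
    refine ((A j).2.1.z_deriv i).congr (fun t h1 h2 => ?_) fun t h1 h2 => ?_
    · simp only [(hagree _ (hAC j) t h1 h2).2]
    · simp only [(hagree _ (hAC j) t h1.le h2).1, (hagree _ (hAC j) t h1.le h2).2]
  · exact (P S.t₀).2.2.1
  · exact (P S.t₀).2.2.2

end SolutionFrom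

/-- Zorn's lemma for extension of solutions. A first solution arises by continuing constant states
from the degenerate interval `[t₀, t₀]`, where the differential equation is vacuous. -/
theorem exists_maximalSolution (hreg : S.IsRegular) (hgain : S.HasBoundedInverseGain)
    (hc : c.IsAdmissible S.t₀) {y₀ : Fin N → Fin m → ℝ} (z₀ : (i : Fin N) → Fin (n i) → ℝ)
    (hinit : c.InFunnel S.t₀ y₀) :
    ∃ (ω : EReal) (y : ℝ → Fin N → Fin m → ℝ) (z : ℝ → (i : Fin N) → Fin (n i) → ℝ),
      S.IsMaximalSolution c ω y z ∧ y S.t₀ = y₀ ∧ z S.t₀ = z₀ := by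
  obtain ⟨b, -, y, z, hsol, hyz⟩ := exists_continuation (y := fun _ => y₀) (z := fun _ => z₀)
    (K := 0) hreg hgain hc le_rfl (LipschitzWith.const _).lipschitzOnWith
    (LipschitzWith.const _).lipschitzOnWith
    (fun t ht => by rw [Icc_self] at ht; rw [mem_singleton_iff.1 ht]; exact hinit)
    (fun i => Eventually.of_forall fun t h1 h2 => absurd h1 h2.not_gt)
  have h0 := hyz S.t₀ ⟨le_rfl, le_rfl⟩
  have : Nonempty (SolutionFrom S c y₀ z₀) := ⟨⟨(b, y, z), hsol, h0.1, h0.2⟩⟩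
  obtain ⟨q, hq⟩ := exists_maximal_of_nonempty_chains_bounded
    (r := SolutionFrom.Extends (S := S) (c := c) (y₀ := y₀) (z₀ := z₀))
    (fun C hC hne => SolutionFrom.exists_extends_of_chain hC hne)
    (fun {p q r} hpq hqr => ⟨hpq.1.trans hqr.1, fun t h1 h2 =>
      ⟨((hqr.2 t h1 (h2.trans_le hpq.1)).1).trans (hpq.2 t h1 h2).1,
        ((hqr.2 t h1 (h2.trans_le hpq.1)).2).trans (hpq.2 t h1 h2).2⟩⟩)
  refine ⟨q.1.1, q.1.2.1, q.1.2.2, ⟨q.2.1, fun ω' y' z' hsol' hle hag => ?_⟩, q.2.2.1, q.2.2.2⟩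
  have hag0 := hag S.t₀ le_rfl q.2.1.lt
  refine le_antisymm ?_ hle
  exact (hq ⟨(ω', y', z'), hsol', hag0.1.trans q.2.2.1, hag0.2.trans q.2.2.2⟩ ⟨hle, hag⟩).1

/-- A maximal solution that is Lipschitz and stays away from the funnel boundary is global. -/
theorem IsMaximalSolution.eq_top_of_lipschitz (hreg : S.IsRegular)
    (hgain : S.HasBoundedInverseGain) (hc : c.IsAdmissible S.t₀) {ω : EReal}
    {y : ℝ → Fin N → Fin m → ℝ} {z : ℝ → (i : Fin N) → Fin (n i) → ℝ}
    (h : S.IsMaximalSolution c ω y z) {K : NNReal}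
    (hy : LipschitzOnWith K y {t | S.t₀ ≤ t ∧ (t : EReal) < ω})
    (hz : LipschitzOnWith K z {t | S.t₀ ≤ t ∧ (t : EReal) < ω}) {ε : ℝ} (hε : 0 < ε)
    (hmargin : ∀ i j, c.graph.Adj i j → ∀ p t, S.t₀ ≤ t → (t : EReal) < ω →
      |y t j p - y t i p| ≤ (1 - ε) * c.ψ i j p t) : ω = ⊤ := by
  by_contra hω
  have hlt := h.1.lt
  lift ω to ℝ using ⟨hω, (bot_le.trans_lt hlt).ne'⟩
  have hlt' : S.t₀ < ω := EReal.coe_lt_coe_iff.1 hlt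
  have hset : {t : ℝ | S.t₀ ≤ t ∧ (t : EReal) < (ω : EReal)} = Ico S.t₀ ω := by
    ext t
    simp only [mem_ofPred_eq, EReal.coe_lt_coe_iff, mem_Ico]
  rw [hset] at hy hz
  -- The Lipschitz extension supplies the limit of the solution at the finite end time.
  obtain ⟨y', hy', hyy⟩ := hy.extend_finite_dimension
  obtain ⟨z', hz', hzz⟩ := hz.extend_finite_dimension
  have hin : ∀ t ∈ Icc S.t₀ ω, c.InFunnel t (y' t) := by
    intro t ht
    rcases ht.2.lt_or_eq with htω | rfl
    · rw [← hyy ⟨ht.1, htω⟩]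
      exact h.1.inFunnel t ht.1 (EReal.coe_lt_coe htω)
    -- In the limit the margin survives as a non-strict inequality, and `ε ψ > 0` at the end time
    -- makes the funnel condition strict again.
    · intro i j hij p
      have hsub : ∀ᶠ s in 𝓝[<] t, s ∈ Ioo S.t₀ t := Ioo_mem_nhdsLT hlt'
      have h1 : Tendsto (fun s => |y' s j p - y' s i p|) (𝓝[<] t) (𝓝 |y' t j p - y' t i p|) := by
        have hyc := hy'.continuous
        exact (Continuous.tendsto (by fun_prop) t).mono_left nhdsWithin_le_nhds
      have h2 : Tendsto (fun s => (1 - ε) * c.ψ i j p s) (𝓝[<] t) (𝓝 ((1 - ε) * c.ψ i j p t)) :=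
        Tendsto.const_mul _ (((hc.continuousOn hij p).continuousAt
          (Ici_mem_nhds hlt')).tendsto.mono_left nhdsWithin_le_nhds)
      have h3 := le_of_tendsto_of_tendsto h1 h2 (by
        filter_upwards [hsub] with s hs
        rw [← hyy ⟨hs.1.le, hs.2⟩]
        exact hmargin i j hij p s hs.1.le (EReal.coe_lt_coe hs.2))
      have := mul_pos hε (hc.ψ_pos i j hij p t ht.1)
      linarith
  obtain ⟨b, hb, y₂, z₂, hsol, hag⟩ := exists_continuation hreg hgain hc hlt'.le
    (K := max (lipschitzExtensionConstant (Fin N → Fin m → ℝ) * K)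
      (lipschitzExtensionConstant ((i : Fin N) → Fin (n i) → ℝ) * K))
    ((hy'.weaken (le_max_left _ _)).lipschitzOnWith)
    ((hz'.weaken (le_max_right _ _)).lipschitzOnWith) hin (fun i => by
      filter_upwards [(h.1.y_deriv_edgeSum hgain i).2, (h.1.z_deriv i).2] with t h1 h2 h3 h4
      have h5 : ∀ᶠ s in 𝓝 t, s ∈ Ico S.t₀ ω := Ico_mem_nhds h3 h4
      rw [← hyy ⟨h3.le, h4⟩, ← hzz ⟨h3.le, h4⟩]
      refine ⟨(h1 h3 (EReal.coe_lt_coe h4)).congr_of_eventuallyEq ?_,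
        (h2 h3 (EReal.coe_lt_coe h4)).congr_of_eventuallyEq ?_⟩
      · filter_upwards [h5] with s hs using by rw [hyy hs]
      · filter_upwards [h5] with s hs using by rw [hzz hs])
  have := h.2 b y₂ z₂ hsol (EReal.coe_lt_coe hb).le (fun t h1 h2 => by
    have ht : t < ω := EReal.coe_lt_coe_iff.1 h2
    rw [hyy ⟨h1, ht⟩, hzz ⟨h1, ht⟩]
    exact hag t ⟨h1, ht.le⟩)
  exact hb.ne' (EReal.coe_eq_coe_iff.1 this)

end AgentNetwork

/-! ### The envelope `Ψ`, deviations from the average and cancellation of the couplings. -/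

namespace FunnelCoupling

variable {N m : ℕ} {c : FunnelCoupling N m} {t₀ : ℝ}

theorem le_Psi {i j : Fin N} (hij : c.graph.Adj i j) (p : Fin m) (t : ℝ) :
    c.ψ i j p t ≤ c.Psi t :=
  le_ciSup (f := fun q : {q : Fin N × Fin N × Fin m // c.graph.Adj q.1 q.2.1} =>
    c.ψ q.1.1 q.1.2.1 q.1.2.2 t) (Set.finite_range _).bddAbove ⟨(i, j, p), hij⟩

theorem IsAdmissible.Psi_nonneg (hc : c.IsAdmissible t₀) {t : ℝ} (ht : t₀ ≤ t) : 0 ≤ c.Psi t :=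
  Real.iSup_nonneg fun q => (hc.ψ_pos _ _ q.2 _ t ht).le

theorem IsAdmissible.exists_Psi_le (hc : c.IsAdmissible t₀) :
    ∃ B, 0 ≤ B ∧ ∀ t, t₀ ≤ t → c.Psi t ≤ B := by
  have h : ∀ q : {q : Fin N × Fin N × Fin m // c.graph.Adj q.1 q.2.1},
      ∀ᶠ B : ℝ in atTop, ∀ t, t₀ ≤ t → c.ψ q.1.1 q.1.2.1 q.1.2.2 t ≤ B := by
    intro q
    obtain ⟨b, hb⟩ := hc.ψ_bounded _ _ q.2 q.1.2.2
    filter_upwards [eventually_ge_atTop b] with B hB t ht using (hb t ht).trans hB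
  obtain ⟨B, hB, hB0⟩ := ((eventually_all.2 h).and (eventually_ge_atTop 0)).exists
  exact ⟨B, hB0, fun t ht => Real.iSup_le (fun q => hB q t ht) hB0⟩

/-- A finite maximum inherits the common Lipschitz constant. This keeps perturbations clamped at `d
Ψ` absolutely continuous. -/
theorem IsAdmissible.exists_Psi_lipschitz (hc : c.IsAdmissible t₀) :
    ∃ B : NNReal, LipschitzOnWith B c.Psi (Ici t₀) := by
  obtain ⟨B, hB⟩ := hc.lipschitz
  refine ⟨B, LipschitzOnWith.of_le_add_mul B fun s hs t ht => ?_⟩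
  refine Real.iSup_le (fun q => ?_) (add_nonneg (hc.Psi_nonneg ht) (by positivity))
  have h1 := (hB _ _ q.2 q.1.2.2).dist_le_mul s hs t ht
  rw [Real.dist_eq] at h1
  have h2 := (le_abs_self _).trans h1
  have h3 := le_Psi q.2 q.1.2.2 t
  linarith

theorem abs_sub_le_length_mul_Psi {t : ℝ} {y : Fin N → Fin m → ℝ} (hy : c.InFunnel t y)
    (p : Fin m) {i j : Fin N} (w : c.graph.Walk i j) : |y j p - y i p| ≤ w.length * c.Psi t := by
  induction w with
  | nil => simp
  | @cons a b d hab w ih =>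
    have h1 := (hy a b hab p).le.trans (le_Psi hab p t)
    have h2 := abs_sub_le (y d p) (y b p) (y a p)
    rw [SimpleGraph.Walk.length_cons]
    push_cast
    linarith

theorem IsAdmissible.abs_sub_le_diam_mul_Psi (hc : c.IsAdmissible t₀) {t : ℝ} (ht : t₀ ≤ t)
    {y : Fin N → Fin m → ℝ} (hy : c.InFunnel t y) (i j : Fin N) (p : Fin m) :
    |y i p - y j p| ≤ c.graph.diam * c.Psi t := by
  have : Nonempty (Fin N) := hc.connected.nonempty
  obtain ⟨w, hw⟩ := hc.connected.exists_walk_length_eq_dist j i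
  have h1 := abs_sub_le_length_mul_Psi hy p w
  have h2 : w.length ≤ c.graph.diam := by
    rw [hw]
    exact SimpleGraph.dist_le_diam (SimpleGraph.connected_iff_ediam_ne_top.1 hc.connected)
  have h3 : (w.length : ℝ) ≤ c.graph.diam := by exact_mod_cast h2
  exact h1.trans (mul_le_mul_of_nonneg_right h3 (hc.Psi_nonneg ht))

/-- The deviation is the average of the pairwise differences, each bounded along a shortest path.
This is exactly the size allowed in `NoFiniteEscape`. -/
theorem IsAdmissible.norm_sub_average_le (hc : c.IsAdmissible t₀) {t : ℝ} (ht : t₀ ≤ t)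
    {y : Fin N → Fin m → ℝ} (hy : c.InFunnel t y) (i : Fin N) :
    ‖y i - (1 / (N : ℝ)) • ∑ j, y j‖ ≤ c.graph.diam * c.Psi t := by
  have : Nonempty (Fin N) := hc.connected.nonempty
  have hN : (0 : ℝ) < N := by exact_mod_cast Fin.pos (Classical.arbitrary (Fin N))
  have h0 : 0 ≤ (c.graph.diam : ℝ) * c.Psi t :=
    mul_nonneg (Nat.cast_nonneg _) (hc.Psi_nonneg ht)
  refine (pi_norm_le_iff_of_nonneg h0).2 fun p => ?_
  have e : (y i - (1 / (N : ℝ)) • ∑ j, y j) p = (1 / (N : ℝ)) * ∑ j, (y i p - y j p) := by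
    simp only [Pi.sub_apply, Pi.smul_apply, Finset.sum_apply, smul_eq_mul, Finset.sum_sub_distrib,
      Finset.sum_const, Finset.card_univ, Fintype.card_fin, nsmul_eq_mul]
    field_simp
  rw [e, Real.norm_eq_abs, abs_mul, abs_of_pos (by positivity), one_div_mul_eq_div,
    div_le_iff₀ hN]
  refine (Finset.abs_sum_le_sum_abs _ _).trans ?_
  rw [mul_comm]
  exact Finset.sum_le_card_mul h0 (fun j _ => hc.abs_sub_le_diam_mul_Psi ht hy i j p) (by simp)

/-- The couplings cancel in the sum over all agents. -/
theorem IsAdmissible.sum_edgeSum (hc : c.IsAdmissible t₀) {t : ℝ} (ht : t₀ ≤ t)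
    {y : Fin N → Fin m → ℝ} (hy : c.InFunnel t y) : ∑ i, c.edgeSum i t y = 0 := by
  classical
  funext p
  rw [Finset.sum_apply, Pi.zero_apply]
  simp only [edgeSum_apply, Finset.sum_filter]
  have h : ∀ i j : Fin N,
      (if c.graph.Adj i j then c.μ i j p ((y j p - y i p) / c.ψ i j p t) else 0) =
        -if c.graph.Adj j i then c.μ j i p ((y i p - y j p) / c.ψ j i p t) else 0 := by
    intro i j
    by_cases hij : c.graph.Adj i j
    · rw [if_pos hij, if_pos hij.symm, ← hc.ψ_symm i j hij p t ht]
      have hpos := hc.ψ_pos i j hij p t ht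
      have hs : (y i p - y j p) / c.ψ i j p t ∈ Ioo (-1 : ℝ) 1 := by
        rw [mem_Ioo, ← abs_lt, abs_div, abs_of_pos hpos, div_lt_one hpos, abs_sub_comm]
        exact hy i j hij p
      rw [← hc.μ_symm i j hij p _ hs, ← neg_div, neg_sub]
    · rw [if_neg hij, if_neg fun h => hij h.symm, neg_zero]
  -- Exchanging the indices turns the double sum into its own negative.
  have h2 : ∑ i, ∑ j, (if c.graph.Adj i j then c.μ i j p ((y j p - y i p) / c.ψ i j p t) else 0) =
      -∑ i, ∑ j, (if c.graph.Adj i j then c.μ i j p ((y j p - y i p) / c.ψ i j p t) else 0) := by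
    conv_lhs => rw [Finset.sum_comm]
    rw [← Finset.sum_neg_distrib]
    refine Finset.sum_congr rfl fun i _ => ?_
    rw [← Finset.sum_neg_distrib]
    exact Finset.sum_congr rfl fun j _ => h j i
  linarith

end FunnelCoupling

/-! ### Uniqueness for the blended dynamics. -/

/-- The integral of an integrable function over a short interval is at most `1 / 2`. -/
theorem exists_integral_le_half {L : ℝ → ℝ} {t T : ℝ} (htT : t < T)
    (hL : IntegrableOn L (Icc t T)) : ∀ᶠ τ in 𝓝[>] t, ∫ r in t..τ, L r ≤ 1 / 2 := by
  have h := intervalIntegral.continuousOn_primitive_interval (a := t) (b := T) (f := L)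
    (μ := volume) (by rwa [uIcc_of_le htT.le])
  rw [uIcc_of_le htT.le] at h
  have h1 := (h t (left_mem_Icc.2 htT.le)).tendsto
  rw [intervalIntegral.integral_same] at h1
  have h2 : 𝓝[>] t ≤ 𝓝[Icc t T] t := by
    rw [← nhdsWithin_Ioo_eq_nhdsGT htT]
    exact nhdsWithin_mono _ Ioo_subset_Icc_self
  filter_upwards [(h1.mono_left h2).eventually (gt_mem_nhds (by norm_num : (0 : ℝ) < 1 / 2))]
    with τ hτ using hτ.le

namespace AgentNetwork

variable {N m : ℕ} {n k : Fin N → ℕ} {S : AgentNetwork N m n k} {c : FunnelCoupling N m}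

/-- Uniqueness for the perturbed blended dynamics. -/
theorem IsRegular.blended_unique (hreg : S.IsRegular) {ω : EReal} {e : ℝ → Fin N → Fin m → ℝ}
    (he : ContinuousOn e (Ici S.t₀)) {s s' : ℝ → Fin m → ℝ}
    {z z' : ℝ → (i : Fin N) → Fin (n i) → ℝ}
    (hs : HasCaratheodoryDeriv S.t₀ ω s
      (fun t => (1 / (N : ℝ)) • ∑ i, S.F i t (s t + e t i) (z t i)))
    (hz : ∀ i, HasCaratheodoryDeriv S.t₀ ω (fun t => z t i)
      (fun t => S.Z i t (z t i) (s t + e t i)))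
    (hs' : HasCaratheodoryDeriv S.t₀ ω s'
      (fun t => (1 / (N : ℝ)) • ∑ i, S.F i t (s' t + e t i) (z' t i)))
    (hz' : ∀ i, HasCaratheodoryDeriv S.t₀ ω (fun t => z' t i)
      (fun t => S.Z i t (z' t i) (s' t + e t i)))
    (hs0 : s S.t₀ = s' S.t₀) (hz0 : z S.t₀ = z' S.t₀) {T : ℝ} (hT : S.t₀ ≤ T)
    (hTω : (T : EReal) < ω) : s T = s' T ∧ z T = z' T := by
  have hsc := hs.continuousOn hT hTω
  have hsc' := hs'.continuousOn hT hTω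
  have hzc : ContinuousOn z (Icc S.t₀ T) := continuousOn_pi.2 fun i => (hz i).continuousOn hT hTω
  have hzc' : ContinuousOn z' (Icc S.t₀ T) :=
    continuousOn_pi.2 fun i => (hz' i).continuousOn hT hTω
  have hec : ContinuousOn e (Icc S.t₀ T) := he.mono Icc_subset_Ici_self
  let A : Set ℝ := {t | s t = s' t ∧ z t = z' t}
  have hcl : IsClosed (A ∩ Icc S.t₀ T) := by
    have : A ∩ Icc S.t₀ T =
        {t ∈ Icc S.t₀ T | ‖((s t, z t) : (Fin m → ℝ) × _) - (s' t, z' t)‖ ≤ 0} := by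
      ext t
      simp only [A, mem_inter_iff, mem_ofPred_eq, norm_le_zero_iff, sub_eq_zero, Prod.mk.injEq]
      exact and_comm
    rw [this]
    exact isClosed_Icc.isClosed_le ((hsc.prodMk hzc).sub (hsc'.prodMk hzc')).norm
      continuousOn_const
  refine hcl.Icc_subset_of_forall_exists_gt ⟨hs0, hz0⟩ ?_ (right_mem_Icc.2 hT)
  rintro t ⟨⟨hst, hzt⟩, ht⟩ y hy
  have htI : t ∈ Icc S.t₀ T := Ico_subset_Icc_self ht
  have hnhds : 𝓝[>] t ≤ 𝓝[Icc S.t₀ T] t := by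
    rw [← nhdsWithin_Ioo_eq_nhdsGT ht.2]
    exact nhdsWithin_mono _ fun r hr => ⟨ht.1.trans hr.1.le, hr.2.le⟩
  choose U hU L hLi hL using fun i =>
    (hreg.F_field i).locallyLipschitz (s t + e t i, z t i)
  choose U' hU' L' hLi' hL' using fun i =>
    (hreg.Z_field i).locallyLipschitz (s t + e t i, z t i)
  -- One integrable rate dominates all agents: the sum over `i` also covers the averaged equation,
  -- as `1 / N ≤ 1`.
  let Λ : ℝ → ℝ := fun r => ∑ i, (|L i r| + |L' i r|)
  have hΛ : IntegrableOn Λ (Icc t T) := by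
    refine integrable_finsetSum _ fun i _ => ?_
    have hsub : Icc t T ⊆ Ici S.t₀ := fun r hr => ht.1.trans hr.1
    exact ((hLi i).integrableOn_compact_subset hsub isCompact_Icc).abs.add
      ((hLi' i).integrableOn_compact_subset hsub isCompact_Icc).abs
  have hΛL : ∀ i r, |L i r| + |L' i r| ≤ Λ r := fun i r =>
    Finset.single_le_sum (f := fun i => |L i r| + |L' i r|) (fun j _ => by positivity)
      (Finset.mem_univ i)
  have hin : ∀ᶠ r in 𝓝[>] t, ∀ i, (s r + e r i, z r i) ∈ U i ∩ U' i := by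
    refine eventually_all.2 fun i => ?_
    have hc : ContinuousOn (fun r => (s r + e r i, z r i)) (Icc S.t₀ T) :=
      (hsc.add (continuousOn_pi.1 hec i)).prodMk (continuousOn_pi.1 hzc i)
    exact ((hc t htI).tendsto.mono_left hnhds) (inter_mem (hU i) (hU' i))
  have hin' : ∀ᶠ r in 𝓝[>] t, ∀ i, (s' r + e r i, z' r i) ∈ U i ∩ U' i := by
    refine eventually_all.2 fun i => ?_
    have hc : ContinuousOn (fun r => (s' r + e r i, z' r i)) (Icc S.t₀ T) :=
      (hsc'.add (continuousOn_pi.1 hec i)).prodMk (continuousOn_pi.1 hzc' i)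
    refine ((hc t htI).tendsto.mono_left hnhds) ?_
    rw [← hst, ← hzt]
    exact inter_mem (hU i) (hU' i)
  obtain ⟨u, hu, hu'⟩ := mem_nhdsGT_iff_exists_Ioo_subset.1 (hin.and hin')
  obtain ⟨τ, ⟨⟨hτ1, hτu⟩, hτy⟩, hτT⟩ := (((exists_integral_le_half ht.2 hΛ).and
    (Ioo_mem_nhdsGT hu)).and (Ioc_mem_nhdsGT hy)).and (Ioo_mem_nhdsGT ht.2) |>.exists
  have hsub : Icc t τ ⊆ Icc S.t₀ T := Icc_subset_Icc ht.1 hτT.2.le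
  -- Let `δ` be the largest discrepancy on `[t, τ]`. It vanishes at `t` and grows at most at rate `Λ
  -- δ` with `∫ Λ ≤ 1 / 2`, so `δ ≤ δ / 2`.
  obtain ⟨r₀, hr₀, hmax⟩ := isCompact_Icc.exists_isMaxOn (nonempty_Icc.2 hτT.1.le)
    ((((hsc.prodMk hzc).sub (hsc'.prodMk hzc')).norm).mono hsub)
  set δ : ℝ := ‖((s r₀, z r₀) : (Fin m → ℝ) × _) - (s' r₀, z' r₀)‖ with hδ
  have hδ0 : 0 ≤ δ := norm_nonneg _
  have hle : ∀ r ∈ Icc t τ, ‖s r - s' r‖ ≤ δ ∧ ∀ i, ‖z r i - z' r i‖ ≤ δ := by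
    intro r hr
    have h1 : ‖((s r, z r) : (Fin m → ℝ) × _) - (s' r, z' r)‖ ≤ δ := hmax hr
    exact ⟨(le_max_left _ _).trans h1, fun i =>
      ((norm_le_pi_norm (z r - z' r) i).trans (le_max_right _ _)).trans h1⟩
  have hr₀ω : (r₀ : EReal) < ω :=
    lt_of_le_of_lt (EReal.coe_le_coe (hr₀.2.trans hτT.2.le)) hTω
  have hΛδ : IntervalIntegrable (fun r => Λ r * δ) volume t r₀ := by
    refine IntervalIntegrable.mul_const ?_ δ
    rw [intervalIntegrable_iff_integrableOn_Icc_of_le hr₀.1]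
    exact hΛ.mono_set (Icc_subset_Icc_right (hr₀.2.trans hτT.2.le))
  have hint : ∫ r in t..r₀, Λ r * δ ≤ δ / 2 := by
    have h1 : ∫ r in t..r₀, Λ r ≤ ∫ r in t..τ, Λ r := by
      refine intervalIntegral.integral_mono_interval le_rfl hr₀.1 hr₀.2
        (Eventually.of_forall fun r => Finset.sum_nonneg fun i _ => by positivity) ?_
      rw [intervalIntegrable_iff_integrableOn_Icc_of_le hτT.1.le]
      exact hΛ.mono_set (Icc_subset_Icc_right hτT.2.le)
    rw [intervalIntegral.integral_mul_const]
    have := mul_le_mul_of_nonneg_right (h1.trans hτ1) hδ0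
    linarith
  have hdiff : ∀ r ∈ Ioo t r₀, ∀ i,
      ‖S.F i r (s r + e r i) (z r i) - S.F i r (s' r + e r i) (z' r i)‖ ≤ |L i r| * δ ∧
      ‖S.Z i r (z r i) (s r + e r i) - S.Z i r (z' r i) (s' r + e r i)‖ ≤ |L' i r| * δ := by
    intro r hr i
    have hrτ : r ∈ Icc t τ := ⟨hr.1.le, hr.2.le.trans hr₀.2⟩
    have hr0 : S.t₀ ≤ r := ht.1.trans hr.1.le
    obtain ⟨hm, hm'⟩ := hu' ⟨hr.1, (hr.2.trans_le hr₀.2).trans hτu.2⟩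
    have hd : ‖((s r + e r i, z r i) : (Fin m → ℝ) × (Fin (n i) → ℝ)) -
        (s' r + e r i, z' r i)‖ ≤ δ := by
      refine max_le ?_ ((hle r hrτ).2 i)
      change ‖s r + e r i - (s' r + e r i)‖ ≤ δ
      rw [add_sub_add_right_eq_sub]
      exact (hle r hrτ).1
    constructor
    · exact (hL i r hr0 _ (hm i).1 _ (hm' i).1).trans
        (mul_le_mul (le_abs_self _) hd (norm_nonneg _) (abs_nonneg _))
    · exact (hL' i r hr0 _ (hm i).2 _ (hm' i).2).trans
        (mul_le_mul (le_abs_self _) hd (norm_nonneg _) (abs_nonneg _))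
  have hsb : ‖s r₀ - s' r₀‖ ≤ δ / 2 := by
    have h1 := (hs.sub hs').norm_sub_le_integral ht.1 hr₀.1 hr₀ω hΛδ (fun r hr => by
      rw [← smul_sub, ← Finset.sum_sub_distrib, norm_smul]
      have hN : ‖1 / (N : ℝ)‖ ≤ 1 := by
        rw [Real.norm_of_nonneg (by positivity)]
        rcases Nat.eq_zero_or_pos N with h | h
        · rw [h]; simp
        · rw [div_le_one (by exact_mod_cast h)]; exact_mod_cast h
      refine (mul_le_of_le_one_left (norm_nonneg _) hN).trans ((norm_sum_le _ _).trans ?_)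
      rw [Finset.sum_mul]
      refine Finset.sum_le_sum fun i _ => (hdiff r hr i).1.trans ?_
      exact mul_le_mul_of_nonneg_right (le_add_of_nonneg_right (abs_nonneg _)) hδ0)
    rw [hst, sub_self, sub_zero] at h1
    exact h1.trans hint
  have hzb : ∀ i, ‖z r₀ i - z' r₀ i‖ ≤ δ / 2 := by
    intro i
    have h1 := ((hz i).sub (hz' i)).norm_sub_le_integral ht.1 hr₀.1 hr₀ω hΛδ (fun r hr => by
      refine (hdiff r hr i).2.trans (mul_le_mul_of_nonneg_right ?_ hδ0)
      exact (le_add_of_nonneg_left (abs_nonneg _)).trans (hΛL i r))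
    rw [hzt, sub_self, sub_zero] at h1
    exact h1.trans hint
  have hδ2 : δ ≤ δ / 2 :=
    max_le hsb ((pi_norm_le_iff_of_nonneg (by positivity)).2 hzb)
  have hδz : δ ≤ 0 := by linarith
  refine ⟨τ, ⟨?_, ?_⟩, hτy⟩
  · exact sub_eq_zero.1 (norm_le_zero_iff.1 (((hle τ ⟨hτT.1.le, le_rfl⟩).1).trans hδz))
  · exact funext fun i =>
      sub_eq_zero.1 (norm_le_zero_iff.1 (((hle τ ⟨hτT.1.le, le_rfl⟩).2 i).trans hδz))

end AgentNetwork

/-! ### Margins, state bounds and global existence. -/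

theorem LipschitzOnWith.pi {ι α : Type*} [Fintype ι] [PseudoMetricSpace α] {E : ι → Type*}
    [∀ i, PseudoMetricSpace (E i)] {K : NNReal} {f : α → ∀ i, E i} {s : Set α}
    (h : ∀ i, LipschitzOnWith K (fun t => f t i) s) : LipschitzOnWith K f s :=
  LipschitzOnWith.of_dist_le_mul fun u hu v hv =>
    (dist_pi_le_iff (by positivity)).2 fun i => (h i).dist_le_mul u hu v hv

/-- Clamping a Lipschitz function between `-ρ` and `ρ` for a Lipschitz `ρ`. -/
theorem LipschitzOnWith.clamp {α : Type*} [PseudoMetricSpace α] {f ρ : α → ℝ} {K : NNReal}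
    {s : Set α} (hf : LipschitzOnWith K f s) (hρ : LipschitzOnWith K ρ s) :
    LipschitzOnWith K (fun t => max (-ρ t) (min (ρ t) (f t))) s := by
  refine LipschitzOnWith.of_dist_le_mul fun u hu v hv => ?_
  have h1 := hf.dist_le_mul u hu v hv
  have h2 := hρ.dist_le_mul u hu v hv
  rw [Real.dist_eq] at h1 h2 ⊢
  refine (abs_max_sub_max_le_max _ _ _ _).trans (max_le ?_
    ((abs_min_sub_min_le_max _ _ _ _).trans (max_le h2 h1)))
  rwa [neg_sub_neg, abs_sub_comm]

namespace AgentNetwork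

variable {N m : ℕ} {n k : Fin N → ℕ} {S : AgentNetwork N m n k} {c : FunnelCoupling N m}
  {ω : EReal} {y : ℝ → Fin N → Fin m → ℝ} {z : ℝ → (i : Fin N) → Fin (n i) → ℝ}

/-- If the uncoupled dynamics of the agents differ by a bounded amount along a solution, the
solution keeps a uniform relative distance from the funnel boundary. -/
theorem IsSolution.exists_margin (h : S.IsSolution c ω y z) (hgain : S.HasBoundedInverseGain)
    (hc : c.IsAdmissible S.t₀) {C : ℝ}
    (hF : ∀ i j t, S.t₀ ≤ t → (t : EReal) < ω →
      ‖S.F i t (y t i) (z t i) - S.F j t (y t j) (z t j)‖ ≤ C) :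
    ∃ ε ∈ Ioo (0 : ℝ) 1, ∀ i j, c.graph.Adj i j → ∀ p t, S.t₀ ≤ t → (t : EReal) < ω →
      |y t j p - y t i p| ≤ (1 - ε) * c.ψ i j p t := by
  classical
  obtain ⟨B, hB⟩ := hc.lipschitz
  have key : ∀ p, ∃ ε ∈ Ioo (0 : ℝ) 1, ∀ i j, c.graph.Adj i j → ∀ t, S.t₀ ≤ t →
      (t : EReal) < ω → |y t j p - y t i p| ≤ (1 - ε) * c.ψ i j p t := by
    intro p
    refine exists_uniform_funnel_margin (G := c.graph) (ψ := fun i j => c.ψ i j p)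
      (μ := fun i j => c.μ i j p) (x := fun i t => y t i p)
      (f := fun i t => S.F i t (y t i) (z t i) p) (B := B) (C := C) h.lt
      (fun i j hij t ht => hc.ψ_pos i j hij p t ht) (fun i j hij t ht => hc.ψ_symm i j hij p t ht)
      (fun i j hij => hB i j hij p) (fun i j hij => hc.μ_cont i j hij p)
      (fun i j hij => hc.μ_right i j hij p) (fun i j hij => hc.μ_left i j hij p) (fun i => ?_)
      (fun i j t h1 h2 => ?_) (fun i j hij t h1 h2 => h.inFunnel t h1 h2 i j hij p)
    · refine ((h.y_deriv_edgeSum hgain i).apply p).congr_deriv fun t _ _ => ?_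
      rw [Pi.add_apply, FunnelCoupling.edgeSum_apply]
    · exact (le_abs_self _).trans ((norm_le_pi_norm _ p).trans (hF i j t h1 h2))
  choose e he hle using key
  -- An `ε` below the margins of all components; taking it near zero also covers `m = 0`.
  obtain ⟨ε, hε, hε1⟩ := ((eventually_all.2 fun p =>
    mem_nhdsWithin_of_mem_nhds (Iio_mem_nhds (he p).1) : ∀ᶠ ε in 𝓝[>] (0 : ℝ), ∀ p, ε < e p).and
    (Ioo_mem_nhdsGT zero_lt_one)).exists
  refine ⟨ε, hε1, fun i j hij p t h1 h2 => (hle p i j hij t h1 h2).trans ?_⟩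
  exact mul_le_mul_of_nonneg_right (by linarith [hε p]) (hc.ψ_pos i j hij p t h1).le

theorem exists_edgeSum_bound (hc : c.IsAdmissible S.t₀) {ε : ℝ} (hε : 0 < ε)
    (hm : ∀ i j, c.graph.Adj i j → ∀ p t, S.t₀ ≤ t → (t : EReal) < ω →
      |y t j p - y t i p| ≤ (1 - ε) * c.ψ i j p t) :
    ∃ K, 0 ≤ K ∧ ∀ i t, S.t₀ ≤ t → (t : EReal) < ω → ‖c.edgeSum i t (y t)‖ ≤ K := by
  obtain ⟨K, hK0, hK⟩ := hc.exists_coupling_bound hε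
  refine ⟨N * K, by positivity, fun i t h1 h2 => FunnelCoupling.norm_edgeSum_le hK0
    fun j hij p => hK i j hij p _ (FunnelCoupling.abs_div_le_of_margin
      (hc.ψ_pos i j hij p t h1) (hm i j hij p t h1 h2))⟩

theorem HasBoundedStates.exists_field_bound (hb : S.HasBoundedStates ω y z) (hreg : S.IsRegular) :
    ∃ M, 0 ≤ M ∧ ∀ i t, S.t₀ ≤ t → (t : EReal) < ω →
      ‖S.F i t (y t i) (z t i)‖ ≤ M ∧ ‖S.Z i t (z t i) (y t i)‖ ≤ M := by
  obtain ⟨R, hR⟩ := hb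
  obtain ⟨M, hM0, hM⟩ := hreg.exists_bound R
  exact ⟨M, hM0, fun i t h1 h2 => hM i t _ _ h1 ((le_max_left _ _).trans (hR i t h1 h2))
    ((le_max_right _ _).trans (hR i t h1 h2))⟩

theorem HasBoundedStates.exists_field_diff_bound (hb : S.HasBoundedStates ω y z)
    (hreg : S.IsRegular) : ∃ C, ∀ i j t, S.t₀ ≤ t → (t : EReal) < ω →
      ‖S.F i t (y t i) (z t i) - S.F j t (y t j) (z t j)‖ ≤ C := by
  obtain ⟨M, -, hM⟩ := hb.exists_field_bound hreg
  exact ⟨M + M, fun i j t h1 h2 => (norm_sub_le _ _).trans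
    (add_le_add (hM i t h1 h2).1 (hM j t h1 h2).1)⟩

/-- The common Lipschitz part sees only output differences, which the funnel bounds by the diameter
times a bound for `Ψ`. Thus the fields differ boundedly even where the states themselves may not be
bounded. -/
theorem HasLipschitzPlusBoundedSplitting.exists_field_diff_bound
    (hF : S.HasLipschitzPlusBoundedSplitting) (hc : c.IsAdmissible S.t₀)
    (h : S.IsSolution c ω y z) : ∃ C, ∀ i j t, S.t₀ ≤ t → (t : EReal) < ω →
      ‖S.F i t (y t i) (z t i) - S.F j t (y t j) (z t j)‖ ≤ C := by
  obtain ⟨Fhat, Ftilde, hsplit, ⟨L, hL⟩, M, hM⟩ := hF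
  obtain ⟨B, hB0, hB⟩ := hc.exists_Psi_le
  refine ⟨|L| * (c.graph.diam * B) + (M + M), fun i j t h1 h2 => ?_⟩
  rw [hsplit i t _ _ h1, hsplit j t _ _ h1, add_sub_add_comm]
  refine (norm_add_le _ _).trans (add_le_add ?_ ((norm_sub_le _ _).trans
    (add_le_add (hM i t _ _ h1) (hM j t _ _ h1))))
  refine (hL t _ _ h1).trans (mul_le_mul (le_abs_self L) ?_ (norm_nonneg _) (abs_nonneg L))
  refine (pi_norm_le_iff_of_nonneg (by positivity)).2 fun p => ?_
  exact (hc.abs_sub_le_diam_mul_Psi h1 (h.inFunnel t h1 h2) i j p).trans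
    (mul_le_mul_of_nonneg_left (hB t h1) (Nat.cast_nonneg _))

/-- A maximal solution with bounded states is global. -/
theorem IsMaximalSolution.eq_top_of_bounded (h : S.IsMaximalSolution c ω y z)
    (hreg : S.IsRegular) (hgain : S.HasBoundedInverseGain) (hc : c.IsAdmissible S.t₀)
    (hb : S.HasBoundedStates ω y z) : ω = ⊤ := by
  obtain ⟨C, hC⟩ := hb.exists_field_diff_bound hreg
  obtain ⟨ε, hε, hm⟩ := h.1.exists_margin hgain hc hC
  obtain ⟨K, hK0, hK⟩ := exists_edgeSum_bound hc hε.1 hm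
  obtain ⟨M, hM0, hM⟩ := hb.exists_field_bound hreg
  refine h.eq_top_of_lipschitz hreg hgain hc (K := ⟨M + K, add_nonneg hM0 hK0⟩)
    (LipschitzOnWith.pi fun i => ?_) (LipschitzOnWith.pi fun i => ?_) hε.1 hm
  · refine (h.1.y_deriv_edgeSum hgain i).lipschitzOnWith fun t h1 h2 => ?_
    exact (norm_add_le _ _).trans (add_le_add (hM i t h1.le h2).1 (hK i t h1.le h2))
  · refine (h.1.z_deriv i).lipschitzOnWith fun t h1 h2 => ?_
    exact (hM i t h1.le h2).2.trans (le_add_of_nonneg_right hK0)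

/-- The average of the outputs obeys the blended dynamics. -/
theorem IsSolution.average_deriv (h : S.IsSolution c ω y z) (hgain : S.HasBoundedInverseGain)
    (hc : c.IsAdmissible S.t₀) :
    HasCaratheodoryDeriv S.t₀ ω (fun t => (1 / (N : ℝ)) • ∑ i, y t i)
      (fun t => (1 / (N : ℝ)) • ∑ i, S.F i t (y t i) (z t i)) := by
  have h1 := (HasCaratheodoryDeriv.finset_sum Finset.univ fun i _ =>
    h.y_deriv_edgeSum hgain i).clm_comp
      ((1 / (N : ℝ)) • ContinuousLinearMap.id ℝ (Fin m → ℝ))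
  refine HasCaratheodoryDeriv.congr_deriv h1 fun t h2 h3 => ?_
  change (1 / (N : ℝ)) • ∑ i, (S.F i t (y t i) (z t i) + c.edgeSum i t (y t)) = _
  rw [Finset.sum_add_distrib, hc.sum_edgeSum h2.le (h.inFunnel t h2.le h3), add_zero]

/-- The deviations from the average extend to admissible perturbations of the blended dynamics. -/
theorem IsSolution.exists_deviation_extension (h : S.IsSolution c ω y z)
    (hgain : S.HasBoundedInverseGain) (hc : c.IsAdmissible S.t₀) {C : ℝ}
    (hF : ∀ i j t, S.t₀ ≤ t → (t : EReal) < ω →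
      ‖S.F i t (y t i) (z t i) - S.F j t (y t j) (z t j)‖ ≤ C) :
    ∃ (e : ℝ → Fin N → Fin m → ℝ) (K : NNReal), LipschitzOnWith K e (Ici S.t₀) ∧
      (∀ i t, S.t₀ ≤ t → ‖e t i‖ ≤ c.graph.diam * c.Psi t) ∧
      ∀ i t, S.t₀ ≤ t → (t : EReal) < ω → e t i = y t i - (1 / (N : ℝ)) • ∑ j, y t j := by
  have : Nonempty (Fin N) := hc.connected.nonempty
  have hN : (0 : ℝ) < N := by exact_mod_cast Fin.pos (Classical.arbitrary (Fin N))
  have hC0 : 0 ≤ C := by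
    have i := Classical.arbitrary (Fin N)
    exact (norm_nonneg _).trans (hF i i S.t₀ le_rfl h.lt)
  obtain ⟨ε, hε, hm⟩ := h.exists_margin hgain hc hF
  obtain ⟨A, hA0, hA⟩ := exists_edgeSum_bound hc hε.1 hm
  obtain ⟨B, hB⟩ := hc.exists_Psi_lipschitz
  let dev : ℝ → Fin N → Fin m → ℝ := fun t i => y t i - (1 / (N : ℝ)) • ∑ j, y t j
  have hdev : ∀ i, HasCaratheodoryDeriv S.t₀ ω (fun t => dev t i)
      (fun t => S.F i t (y t i) (z t i) + c.edgeSum i t (y t) -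
        (1 / (N : ℝ)) • ∑ j, S.F j t (y t j) (z t j)) := fun i =>
    (h.y_deriv_edgeSum hgain i).sub (h.average_deriv hgain hc)
  obtain ⟨L₀, hL₀⟩ : ∃ L₀ : NNReal, (L₀ : ℝ) = C + A := ⟨⟨C + A, add_nonneg hC0 hA0⟩, rfl⟩
  have hlip : LipschitzOnWith L₀ dev
      {t | S.t₀ ≤ t ∧ (t : EReal) < ω} := by
    refine LipschitzOnWith.pi fun i => (hdev i).lipschitzOnWith fun t h1 h2 => ?_
    rw [hL₀]
    -- The deviation moves with an average of field differences plus the coupling; only differences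
    -- of the fields are known to be bounded here.
    have e1 : S.F i t (y t i) (z t i) + c.edgeSum i t (y t) -
        (1 / (N : ℝ)) • ∑ j, S.F j t (y t j) (z t j) =
        (1 / (N : ℝ)) • ∑ j, (S.F i t (y t i) (z t i) - S.F j t (y t j) (z t j)) +
          c.edgeSum i t (y t) := by
      rw [Finset.sum_sub_distrib, Finset.sum_const, Finset.card_univ, Fintype.card_fin, smul_sub,
        ← Nat.cast_smul_eq_nsmul ℝ, smul_smul, one_div_mul_cancel hN.ne', one_smul]
      abel
    rw [e1]
    refine (norm_add_le _ _).trans (add_le_add ?_ (hA i t h1.le h2))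
    rw [norm_smul, Real.norm_of_nonneg (by positivity), one_div_mul_eq_div, div_le_iff₀ hN,
      mul_comm C]
    exact (norm_sum_le _ _).trans (Finset.sum_le_card_mul hC0
      (fun j _ => hF i j t h1.le h2) (by simp))
  obtain ⟨K₁, g, hg, hgd⟩ : ∃ (K₁ : NNReal) (g : ℝ → Fin N → Fin m → ℝ), LipschitzWith K₁ g ∧
      EqOn dev g {t | S.t₀ ≤ t ∧ (t : EReal) < ω} := ⟨_, hlip.extend_finite_dimension⟩
  let ρ : ℝ → ℝ := fun t => c.graph.diam * c.Psi t
  have hρ : LipschitzOnWith (c.graph.diam * B) ρ (Ici S.t₀) := by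
    refine LipschitzOnWith.of_dist_le_mul fun u hu v hv => ?_
    rw [Real.dist_eq, ← mul_sub, abs_mul, Nat.abs_cast]
    have := hB.dist_le_mul u hu v hv
    rw [Real.dist_eq] at this
    push_cast
    rw [mul_assoc]
    exact mul_le_mul_of_nonneg_left this (Nat.cast_nonneg _)
  -- Past `ω` the extension `g` may leave the tube of radius `d Ψ`, hence the clamp. Before `ω` the
  -- clamp is inactive, because the deviation lies in the tube.
  refine ⟨fun t i p => max (-ρ t) (min (ρ t) (g t i p)), max K₁ (c.graph.diam * B),
    LipschitzOnWith.pi fun i => LipschitzOnWith.pi fun p => ?_, fun i t ht => ?_,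
    fun i t h1 h2 => ?_⟩
  · refine LipschitzOnWith.clamp ?_ (hρ.weaken (le_max_right _ _))
    refine LipschitzOnWith.of_dist_le_mul fun u _ v _ => ?_
    exact ((dist_le_pi_dist (g u i) (g v i) p).trans (dist_le_pi_dist (g u) (g v) i)).trans
      ((hg.weaken (le_max_left _ _)).dist_le_mul u v)
  · have hρ0 : 0 ≤ ρ t := mul_nonneg (Nat.cast_nonneg _) (hc.Psi_nonneg ht)
    exact norm_clampVec_le hρ0 (g t i)
  · have h3 := hc.norm_sub_average_le h1 (h.inFunnel t h1 h2) i
    have h4 : g t i = dev t i := by rw [← hgd ⟨h1, h2⟩]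
    change clampVec (ρ t) (g t i) = dev t i
    rw [h4]
    exact clampVec_of_norm_le h3

/-- Up to a finite escape time, the states are bounded by those of the blended dynamics. -/
theorem IsSolution.hasBoundedStates {T : ℝ} (h : S.IsSolution c T y z)
    (hreg : S.IsRegular) (hgain : S.HasBoundedInverseGain) (hc : c.IsAdmissible S.t₀)
    (hesc : S.NoFiniteEscape c) {C : ℝ}
    (hF : ∀ i j t, S.t₀ ≤ t → (t : EReal) < (T : EReal) →
      ‖S.F i t (y t i) (z t i) - S.F j t (y t j) (z t j)‖ ≤ C) :
    S.HasBoundedStates T y z := by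
  obtain ⟨e, K, heL, heb, hey⟩ := h.exists_deviation_extension hgain hc hF
  have hT : S.t₀ ≤ T := (EReal.coe_lt_coe_iff.1 h.lt).le
  obtain ⟨s, z', hs0, hz0, hs, hz⟩ := hesc e (fun i T hT =>
    LipschitzOnWith.absolutelyContinuousOnInterval (K := K)
      (LipschitzOnWith.of_dist_le_mul fun u hu v hv => by
        rw [uIcc_of_le hT] at hu hv
        exact (dist_le_pi_dist (e u) (e v) i).trans (heL.dist_le_mul u hu.1 v hv.1))) heb
    ((1 / (N : ℝ)) • ∑ i, y S.t₀ i) (z S.t₀)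
  have heq : ∀ i t, S.t₀ ≤ t → (t : EReal) < (T : EReal) →
      (1 / (N : ℝ)) • ∑ j, y t j + e t i = y t i := fun i t h1 h2 => by
    rw [hey i t h1 h2, add_sub_cancel]
  have huniq : ∀ t, S.t₀ ≤ t → (t : EReal) < (T : EReal) →
      (1 / (N : ℝ)) • ∑ j, y t j = s t ∧ z t = z' t := by
    intro t h1 h2
    -- The average output and the internal states solve the blended dynamics with `e` as
    -- perturbation, so they coincide with the global solution, which is continuous on the compact
    -- interval `[t₀, T]`.
    refine hreg.blended_unique (ω := T) (s := fun t => (1 / (N : ℝ)) • ∑ j, y t j)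
      heL.continuousOn
      ((h.average_deriv hgain hc).congr_deriv fun r h3 h4 => ?_)
      (fun i => (h.z_deriv i).congr_deriv fun r h3 h4 => ?_) (hs.mono le_top)
      (fun i => (hz i).mono le_top) hs0.symm hz0.symm h1 h2
    · simp only [heq _ r h3.le h4]
    · rw [heq i r h3.le h4]
  have hsc := hs.continuousOn hT (EReal.coe_lt_top T)
  have hzc : ContinuousOn z' (Icc S.t₀ T) :=
    continuousOn_pi.2 fun i => (hz i).continuousOn hT (EReal.coe_lt_top T)
  have hec : ContinuousOn e (Icc S.t₀ T) := heL.continuousOn.mono Icc_subset_Ici_self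
  obtain ⟨R₁, hR₁⟩ := isCompact_Icc.exists_bound_of_continuousOn hsc
  obtain ⟨R₂, hR₂⟩ := isCompact_Icc.exists_bound_of_continuousOn hzc
  obtain ⟨R₃, hR₃⟩ := isCompact_Icc.exists_bound_of_continuousOn hec
  refine ⟨max (R₁ + R₃) R₂, fun i t h1 h2 => ?_⟩
  have htI : t ∈ Icc S.t₀ T := ⟨h1, (EReal.coe_lt_coe_iff.1 h2).le⟩
  obtain ⟨h3, h4⟩ := huniq t h1 h2
  refine max_le_max ?_ ?_
  · change ‖y t i‖ ≤ _
    rw [← heq i t h1 h2, h3]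
    exact (norm_add_le _ _).trans (add_le_add (hR₁ t htI)
      ((norm_le_pi_norm (e t) i).trans (hR₃ t htI)))
  · change ‖z t i‖ ≤ _
    rw [h4]
    exact (norm_le_pi_norm (z' t) i).trans (hR₂ t htI)

theorem exists_input_bound (hgain : S.HasBoundedInverseGain) {K : ℝ}
    (hK0 : 0 ≤ K) (hK : ∀ i t, S.t₀ ≤ t → ‖c.edgeSum i t (y t)‖ ≤ K) :
    ∃ M : ℝ, 0 < M ∧ ∀ t, S.t₀ ≤ t → ∀ i, ‖S.input c i t (y t) (z t)‖ ≤ M := by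
  obtain ⟨-, M, hM0, hM⟩ := hgain
  -- The summand `1` only ensures positivity when `K = 0`.
  refine ⟨M * K + 1, by positivity, fun t ht i => ?_⟩
  refine (Matrix.linfty_opNorm_mulVec _ _).trans ?_
  have h1 := mul_le_mul (hM i t (S.W i (y t i) (z t i)) ht) (hK i t ht) (norm_nonneg _) hM0.le
  linarith

end AgentNetwork

theorem theorem2 {N m : ℕ} {n k : Fin N → ℕ}
    (S : AgentNetwork N m n k) (c : FunnelCoupling N m)
    (hreg : S.IsRegular) (hgain : S.HasBoundedInverseGain)
    (hc : c.IsAdmissible S.t₀) (hesc : S.NoFiniteEscape c)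
    (y₀ : Fin N → Fin m → ℝ) (z₀ : (i : Fin N) → Fin (n i) → ℝ)
    (hinit : c.InFunnel S.t₀ y₀) :
    (∃ (ω : EReal) (y : ℝ → Fin N → Fin m → ℝ) (z : ℝ → (i : Fin N) → Fin (n i) → ℝ),
      S.IsMaximalSolution c ω y z ∧ y S.t₀ = y₀ ∧ z S.t₀ = z₀) ∧
    ∀ (ω : EReal) (y : ℝ → Fin N → Fin m → ℝ) (z : ℝ → (i : Fin N) → Fin (n i) → ℝ),
      S.IsMaximalSolution c ω y z → y S.t₀ = y₀ → z S.t₀ = z₀ →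
      (S.HasLipschitzPlusBoundedSplitting ∨ S.HasBoundedStates ω y z) →
      ω = ⊤ ∧
      ∃ M : ℝ, 0 < M ∧ ∀ t, S.t₀ ≤ t → ∀ i, ‖S.input c i t (y t) (z t)‖ ≤ M := by
  refine ⟨AgentNetwork.exists_maximalSolution hreg hgain hc z₀ hinit, ?_⟩
  intro ω y z h _ _ hab
  obtain ⟨C, hC⟩ : ∃ C, ∀ i j t, S.t₀ ≤ t → (t : EReal) < ω →
      ‖S.F i t (y t i) (z t i) - S.F j t (y t j) (z t j)‖ ≤ C := by
    rcases hab with ha | hb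
    · exact ha.exists_field_diff_bound hc h.1
    · exact hb.exists_field_diff_bound hreg
  have hω : ω = ⊤ := by
    -- Under (a) the states are controlled only up to a finite time, so `ω = ⊤` follows by
    -- contradiction. The bound `C`, and with it the margin, does not depend on the states being
    -- bounded for all times.
    rcases hab with _ | hb
    · by_contra hω
      have hne := hω
      lift ω to ℝ using ⟨hω, (bot_le.trans_lt h.1.lt).ne'⟩
      exact hne (h.eq_top_of_bounded hreg hgain hc (h.1.hasBoundedStates hreg hgain hc hesc hC))
    · exact h.eq_top_of_bounded hreg hgain hc hb
  obtain ⟨ε, hε, hm⟩ := h.1.exists_margin hgain hc hC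
  obtain ⟨K, hK0, hK⟩ := AgentNetwork.exists_edgeSum_bound hc hε.1 hm
  refine ⟨hω, AgentNetwork.exists_input_bound hgain hK0 fun i t ht => hK i t ht ?_⟩
  rw [hω]
  exact EReal.coe_lt_top t
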